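/- Let $\mathscr H$ be a complex Hilbert space. For $p>0$ let $\mathbb B_p(\mathscr H)$ be the set of compact operators $T$ on $\mathscr H$ whose singular values $s_j(T)$ (the eigenvalues of $|T|=(T^*T)^{1/2}$, counted with multiplicity) satisfy $\|T\|_p:=\big(\sum_j s_j(T)^p\big)^{1/p}<\infty$. Call a matrix $U\in\mathbb C^{s\times t}$ subunitary if $U^*U=I_t$. For tuples $X=(X_1,\dots,X_s)$ and $Y=(Y_1,\dots,Y_t)$ in $\mathbb B_p(\mathscr H)$ and a matrix $A=(a_{ij})\in\mathbb C^{s\times t}$ consider the Clarkson–McCarthy type inequalities $(\mathrm{PP}_p)$ for $p\ge 2$, \[ s^{1-\frac p2}\sum_{j=1}^t\|Y_j\|_p^p\le\sum_{i=1}^s\|X_i\|_p^p\le t^{\frac p2-1}\sum_{j=1}^t\|Y_j\|_p^p, \] with both inequalities reversed for $0<p\le 2$; $(\mathrm{PQ}_p)$ for $1<p\le 2$ and $q=p/(p-1)$, \[ \sum_{i=1}^s\|X_i\|_p^q\le\Big(\max_{i,j}|a_{ij}|\Big)^{\frac qp-1}\Big(\sum_{j=1}^t\|Y_j\|_p^p\Big)^{\frac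 qp}, \] with the inequality reversed for $p\ge 2$. Let $A\in\mathbb C^{s\times t}$. (1) If $A$ is subunitary, $p>0$, and $X_1,\dots,X_s,Y_1,\dots,Y_t\in\mathbb B_p(\mathscr H)$ satisfy $(X_1,\dots,X_s)^T=A(Y_1,\dots,Y_t)^T$, then $\sum_i|X_i|^2=\sum_j|Y_j|^2$, and $(\mathrm{PP}_p)$ and $(\mathrm{PQ}_p)$ hold (the latter being asserted for $p>1$ only). (2) If $p>0$ and $X_1,\dots,X_s,Y_1,\dots,Y_t\in\mathbb B_p(\mathscr H)$ are any operators with $\sum_i|X_i|^2=\sum_j|Y_j|^2$, then $(\mathrm{PP}_p)$ holds. (3) Suppose that there exist $t$ linearly independent bounded operators on $\mathscr H$, and let $p_0>0$. Then the following are equivalent: (a) $A$ is subunitary; (b) for all tuples $X,Y$ in $\mathbb B_{p_0}(\mathscr H)$ with $Y_1,\dots,Y_t$ linearly independent and $X^T=AY^T$, there is a subunitary $U\in\mathbb C^{s\times t}$ with $X^T=UY^T$; (c) for all tuples $X,Y$ in $\mathbb B_{p_0}(\mathscr H)$ with $Y_1,\dots,Y_t$ linearly independent and $X^T=AY^T$,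 $\sum_i|X_i|^2=\sum_j|Y_j|^2$; (d) for all $p>0$ and all tuples $X,Y$ in $\mathbb B_p(\mathscr H)$ with $Y_1,\dots,Y_t$ linearly independent and $X^T=AY^T$, $(\mathrm{PP}_p)$ and $(\mathrm{PQ}_p)$ hold (the latter for $p>1$); (e) the same as (d) with $(\mathrm{PP}_p)$ alone; (f) the same as (d) with $(\mathrm{PQ}_p)$ alone, for all $p>1$. -/

import Mathlib

open scoped ENNReal Matrix

noncomputable section

section Schatten

variable {H : Type*} [NormedAddCommGroup H] [InnerProductSpace ℂ H] [CompleteSpace H]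

/-- `∑ⱼ sⱼ(T) ^ p` for a compact operator `T`. The nonzero singular values of `T` are the positive
eigenvalues `r` of `|T| = (T* T)^{1/2}`, each repeated according to the (finite) dimension of its
eigenspace. -/
def schattenSum (p : ℝ) (T : H →L[ℂ] H) : ℝ≥0∞ :=
  ∑' r : {r : ℝ // 0 < r},
    (Module.finrank ℂ (Module.End.eigenspace (CFC.abs T : H →L[ℂ] H).toLinearMap ((r : ℝ) : ℂ)) :
      ℝ≥0∞) * ENNReal.ofReal ((r : ℝ) ^ p)

/-- The Schatten class `B_p(H)`: compact operators `T` with `∑ⱼ sⱼ(T) ^ p < ∞`. -/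
def MemSchatten (p : ℝ) (T : H →L[ℂ] H) : Prop :=
  IsCompactOperator T ∧ schattenSum p T ≠ ∞

/-- `‖T‖_p = (∑ⱼ sⱼ(T) ^ p) ^ (1 / p)`. -/
def schattenNorm (p : ℝ) (T : H →L[ℂ] H) : ℝ :=
  (schattenSum p T).toReal ^ (1 / p)

/-- The tuple `U (Y₁, …, Y_t)ᵀ`. -/
def matrixAct {s t : ℕ} (U : Matrix (Fin s) (Fin t) ℂ) (Y : Fin t → H →L[ℂ] H) :
    Fin s → H →L[ℂ] H :=
  fun i => ∑ j, U i j • Y j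

/-- The identity `∑ᵢ |Xᵢ|² = ∑ⱼ |Yⱼ|²`. -/
def SumSquaresEq {s t : ℕ} (X : Fin s → H →L[ℂ] H) (Y : Fin t → H →L[ℂ] H) : Prop :=
  ∑ i, CFC.abs (X i) ^ 2 = ∑ j, CFC.abs (Y j) ^ 2

/-- The two-sided Clarkson–McCarthy inequality between `∑ᵢ ‖Xᵢ‖_p^p` and `∑ⱼ ‖Yⱼ‖_p^p`:
for `p ≥ 2`, and reversed for `p ≤ 2`. -/
def ClarksonMcCarthyPP {s t : ℕ} (p : ℝ) (X : Fin s → H →L[ℂ] H) (Y : Fin t → H →L[ℂ] H) : Prop :=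
  (2 ≤ p →
    (s : ℝ) ^ (1 - p / 2) * ∑ j, schattenNorm p (Y j) ^ p ≤ ∑ i, schattenNorm p (X i) ^ p ∧
    ∑ i, schattenNorm p (X i) ^ p ≤ (t : ℝ) ^ (p / 2 - 1) * ∑ j, schattenNorm p (Y j) ^ p) ∧
  (p ≤ 2 →
    (t : ℝ) ^ (p / 2 - 1) * ∑ j, schattenNorm p (Y j) ^ p ≤ ∑ i, schattenNorm p (X i) ^ p ∧
    ∑ i, schattenNorm p (X i) ^ p ≤ (s : ℝ) ^ (1 - p / 2) * ∑ j, schattenNorm p (Y j) ^ p)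

/-- The Clarkson–McCarthy inequality with the conjugate exponent `q = p / (p - 1)` and the constant
`(maxᵢⱼ |uᵢⱼ|) ^ (q / p - 1)`: for `1 < p ≤ 2`, and reversed for `p ≥ 2`. -/
def ClarksonMcCarthyPQ {s t : ℕ} (p : ℝ) (U : Matrix (Fin s) (Fin t) ℂ)
    (X : Fin s → H →L[ℂ] H) (Y : Fin t → H →L[ℂ] H) : Prop :=
  (1 < p → p ≤ 2 →
    ∑ i, schattenNorm p (X i) ^ p.conjExponent ≤
      (⨆ ij : Fin s × Fin t, ‖U ij.1 ij.2‖) ^ (p.conjExponent / p - 1) *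
        (∑ j, schattenNorm p (Y j) ^ p) ^ (p.conjExponent / p)) ∧
  (2 ≤ p →
    (⨆ ij : Fin s × Fin t, ‖U ij.1 ij.2‖) ^ (p.conjExponent / p - 1) *
        (∑ j, schattenNorm p (Y j) ^ p) ^ (p.conjExponent / p) ≤
      ∑ i, schattenNorm p (X i) ^ p.conjExponent)

/-- `X` and `Y` are tuples in `B_p(H)` with `(X₁, …, X_s)ᵀ = A (Y₁, …, Y_t)ᵀ`. -/
def SchattenRelated {s t : ℕ} (p : ℝ) (A : Matrix (Fin s) (Fin t) ℂ)
    (X : Fin s → H →L[ℂ] H) (Y : Fin t → H →L[ℂ] H) : Prop :=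
  (∀ i, MemSchatten p (X i)) ∧ (∀ j, MemSchatten p (Y j)) ∧ X = matrixAct A Y

end Schatten

/-- A subunitary matrix: its columns are orthonormal, `U* U = I`. -/
def IsSubunitary {s t : ℕ} (U : Matrix (Fin s) (Fin t) ℂ) : Prop :=
  Uᴴ * U = 1

end

/-! Singular value decompositions turn Schatten norms into ℓ^p sums, and everything is proved for
these sums.

(PP): only K = ∑ Xᵢ*Xᵢ matters. It equals T*T for the column operator T = (X₁, …, Xₙ), and
`schattenSum_column_bounds` compares ∑ ‖Xᵢ‖_p^p with the Schatten sum of T, with constant 1 on one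
side and a power of n on the other. The tools are Jensen's inequality with weights |⟨e_k, v_m⟩|² and
the power mean inequality. Two tuples with the same K are then compared through K.

(PQ): in singular coordinates X = AY becomes a relation x = Bσ between the families of singular
values, where B has the entries `singularMatrix`. Bessel's inequality bounds B from ℓ¹ to ℓ^∞(ℓ¹) by
max |aᵢⱼ|, and subunitarity bounds it by 1 on ℓ² (`norm_singularMatrix_le_max`,
`norm_singularMatrix_le_l2`). The three lines theorem (`norm_bilinear_le_interp`) interpolates to a
bound from ℓ^p to ℓ^q(ℓ^p) for p ≤ 2, and duality yields the inequality. For p ≥ 2 the transposed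
relation, available because Y = A*X, is used with p and q exchanged.

Necessity: at p = 2 each of (PP) and (PQ) collapses to ∑ ‖Xᵢ‖₂² = ∑ ‖Yⱼ‖₂². Linear independence is
an open condition, so Y may be perturbed to Yⱼ ± τcⱼT; the parallelogram law then isolates ‖Ac‖ =
‖c‖ (`isSubunitary_of_schattenNorm_two`). Finite rank tuples suffice, and they lie in every Schatten
class. -/

open scoped InnerProductSpace

/-! ### Bessel and Parseval for orthonormal families, also in `ℝ≥0∞`. -/

section OrthonormalExpansion

variable {E : Type*} [NormedAddCommGroup E] [InnerProductSpace ℂ E] {κ : Type*} {v : κ → E}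

theorem Orthonormal.hasSum_coeff (hv : Orthonormal ℂ v) {c : κ → ℂ} {y : E}
    (h : HasSum (fun k => c k • v k) y) (k : κ) : ⟪v k, y⟫_ℂ = c k := by
  classical
  have h1 : HasSum (fun l => ⟪v k, c l • v l⟫_ℂ) ⟪v k, y⟫_ℂ := h.mapL (innerSL ℂ (v k))
  have h2 : HasSum (fun l => ⟪v k, c l • v l⟫_ℂ) ⟪v k, c k • v k⟫_ℂ := by
    refine hasSum_single k fun l hl => ?_
    rw [inner_smul_right, hv.2 (Ne.symm hl), mul_zero]
  rw [h1.unique h2, inner_smul_right, inner_self_eq_norm_sq_to_K, hv.1 k]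
  simp

theorem Orthonormal.hasSum_norm_sq (hv : Orthonormal ℂ v) {c : κ → ℂ} {y : E}
    (h : HasSum (fun k => c k • v k) y) : HasSum (fun k => ‖c k‖ ^ 2) (‖y‖ ^ 2) := by
  have h1 : HasSum (fun k => ⟪y, c k • v k⟫_ℂ) ⟪y, y⟫_ℂ := h.mapL (innerSL ℂ y)
  have h2 := h1.mapL Complex.reCLM
  convert h2 using 1
  · funext k
    rw [inner_smul_right, ← inner_conj_symm, hv.hasSum_coeff h k]
    simp [Complex.mul_conj, Complex.normSq_eq_norm_sq]
    norm_cast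
  · rw [inner_self_eq_norm_sq_to_K]
    simp
    norm_cast

theorem enorm_sq_eq_ofReal {G : Type*} [SeminormedAddGroup G] (x : G) :
    ‖x‖ₑ ^ 2 = ENNReal.ofReal (‖x‖ ^ 2) := by
  rw [ENNReal.ofReal_pow (norm_nonneg x), ofReal_norm]

theorem Orthonormal.tsum_enorm_sq (hv : Orthonormal ℂ v) {c : κ → ℂ} {y : E}
    (h : HasSum (fun k => c k • v k) y) : ∑' k, ‖c k‖ₑ ^ 2 = ‖y‖ₑ ^ 2 := by
  have h1 := hv.hasSum_norm_sq h
  simp only [enorm_sq_eq_ofReal]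
  rw [← h1.tsum_eq, ENNReal.ofReal_tsum_of_nonneg (fun _ => sq_nonneg _) h1.summable]

theorem Orthonormal.tsum_enorm_inner_sq_le (hv : Orthonormal ℂ v) (x : E) :
    ∑' k, ‖⟪v k, x⟫_ℂ‖ₑ ^ 2 ≤ ‖x‖ₑ ^ 2 := by
  simp only [enorm_sq_eq_ofReal]
  rw [← ENNReal.ofReal_tsum_of_nonneg (fun _ => sq_nonneg _) (hv.inner_products_summable x)]
  exact ENNReal.ofReal_le_ofReal (hv.tsum_inner_products_le x)

theorem Orthonormal.summable_expansion [CompleteSpace E] (hv : Orthonormal ℂ v) (x : E) :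
    Summable fun k => ⟪v k, x⟫_ℂ • v k := by
  have := hv.orthogonalFamily.summable_iff_norm_sq_summable (fun k => ⟪v k, x⟫_ℂ)
  simp only [LinearIsometry.toSpanSingleton_apply] at this
  exact this.2 (hv.inner_products_summable x)

theorem enorm_inner_comm (x y : E) : ‖⟪x, y⟫_ℂ‖ₑ = ‖⟪y, x⟫_ℂ‖ₑ := by
  rw [← ofReal_norm, ← ofReal_norm, norm_inner_symm]

end OrthonormalExpansion

/-! ### Jensen and power mean inequalities in `ℝ≥0∞`. -/

section Jensen

variable {κ : Type*}

/-- Weights of total mass at most 1 are allowed because the missing mass can be put on an extra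
point `none` with value 0. -/
theorem ENNReal.rpow_tsum_mul_le {r : ℝ} (hr : 1 ≤ r) (a c : κ → ℝ≥0∞) (hc : ∑' k, c k ≤ 1) :
    (∑' k, a k * c k) ^ r ≤ ∑' k, a k ^ r * c k := by
  have hr0 : 0 < r := by linarith
  rw [← ENNReal.le_rpow_inv_iff hr0, ENNReal.tsum_eq_iSup_sum]
  refine iSup_le fun F => ?_
  rw [ENNReal.le_rpow_inv_iff hr0]
  refine le_trans ?_ (ENNReal.sum_le_tsum F)
  have hF : ∑ k ∈ F, c k ≤ 1 := (ENNReal.sum_le_tsum F).trans hc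
  have h := ENNReal.rpow_arith_mean_le_arith_mean_rpow (Finset.insertNone F)
    (fun o => o.elim (1 - ∑ k ∈ F, c k) c) (fun o => o.elim 0 a)
    (by simpa [Finset.sum_insertNone] using tsub_add_cancel_of_le hF) hr
  simpa [Finset.sum_insertNone, ENNReal.zero_rpow_of_pos hr0, mul_comm] using h

theorem ENNReal.tsum_rpow_mul_le {r : ℝ} (hr0 : 0 < r) (hr : r ≤ 1) (a c : κ → ℝ≥0∞)
    (hc : ∑' k, c k ≤ 1) : ∑' k, a k ^ r * c k ≤ (∑' k, a k * c k) ^ r := by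
  have h := ENNReal.rpow_tsum_mul_le ((one_le_inv₀ hr0).2 hr) (fun k => a k ^ r) c hc
  rw [ENNReal.rpow_inv_le_iff hr0] at h
  simpa [← ENNReal.rpow_mul, hr0.ne'] using h

theorem ENNReal.sum_rpow_le_const_mul_rpow_sum {ι : Type*} (s : Finset ι) (f : ι → ℝ≥0∞) {r : ℝ}
    (hr0 : 0 < r) (hr : r ≤ 1) :
    ∑ i ∈ s, f i ^ r ≤ (s.card : ℝ≥0∞) ^ (1 - r) * (∑ i ∈ s, f i) ^ r := by
  have h := ENNReal.rpow_sum_le_const_mul_sum_rpow s (fun i => f i ^ r) ((one_le_inv₀ hr0).2 hr)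
  rw [ENNReal.rpow_inv_le_iff hr0, ENNReal.mul_rpow_of_nonneg _ _ hr0.le, ← ENNReal.rpow_mul] at h
  have h1 : (r⁻¹ - 1) * r = 1 - r := by field_simp
  simpa [← ENNReal.rpow_mul, hr0.ne', h1] using h

theorem ENNReal.pow_two_rpow_half (x : ℝ≥0∞) (p : ℝ) : (x ^ 2) ^ (p / 2) = x ^ p := by
  rw [← ENNReal.rpow_natCast, ← ENNReal.rpow_mul]
  congr 1
  push_cast
  ring

end Jensen

/-! ### Singular value decompositions and sums of ‖T v_m‖^p. -/

section SingularSystem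

variable {E F : Type*} [NormedAddCommGroup E] [InnerProductSpace ℂ E] [CompleteSpace E]
  [NormedAddCommGroup F] [InnerProductSpace ℂ F] [CompleteSpace F] {κ : Type*}

open ContinuousLinearMap (adjoint)

/-- A singular value decomposition `T = ∑ₖ sₖ ⟪eₖ, ·⟫ fₖ` with positive singular values `sₖ`. -/
structure IsSingularSystem (T : E →L[ℂ] F) (e : κ → E) (f : κ → F) (s : κ → ℝ) : Prop where
  orthonormal_left : Orthonormal ℂ e
  orthonormal_right : Orthonormal ℂ f
  pos : ∀ k, 0 < s k
  apply_left : ∀ k, T (e k) = (s k : ℂ) • f k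
  adjoint_apply_right : ∀ k, adjoint T (f k) = (s k : ℂ) • e k
  apply_eq_zero : ∀ x, (∀ k, ⟪e k, x⟫_ℂ = 0) → T x = 0

namespace IsSingularSystem

variable {T : E →L[ℂ] F} {e : κ → E} {f : κ → F} {s : κ → ℝ}

theorem hasSum_apply (h : IsSingularSystem T e f s) (x : E) :
    HasSum (fun k => ((s k : ℂ) * ⟪e k, x⟫_ℂ) • f k) (T x) := by
  have h1 := (h.orthonormal_left.summable_expansion x).hasSum
  set y := ∑' k, ⟪e k, x⟫_ℂ • e k
  have h2 : T x = T y := by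
    rw [← sub_eq_zero, ← map_sub]
    refine h.apply_eq_zero _ fun k => ?_
    rw [inner_sub_right, h.orthonormal_left.hasSum_coeff h1 k, sub_self]
  rw [h2]
  convert h1.mapL T using 2 with k
  rw [map_smul, h.apply_left, smul_smul, mul_comm]

theorem adjoint (h : IsSingularSystem T e f s) : IsSingularSystem (adjoint T) f e s where
  orthonormal_left := h.orthonormal_right
  orthonormal_right := h.orthonormal_left
  pos := h.pos
  apply_left := h.adjoint_apply_right
  adjoint_apply_right := by simpa using h.apply_left
  apply_eq_zero y hy := by
    refine ext_inner_right ℂ fun x => ?_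
    rw [ContinuousLinearMap.adjoint_inner_left, inner_zero_left]
    have h1 : HasSum (fun k => ⟪y, ((s k : ℂ) * ⟪e k, x⟫_ℂ) • f k⟫_ℂ) ⟪y, T x⟫_ℂ :=
      (h.hasSum_apply x).mapL (innerSL ℂ y)
    refine h1.unique ?_
    convert hasSum_zero with k
    rw [inner_smul_right, ← inner_conj_symm y, hy k]
    simp

theorem enorm_apply_sq (h : IsSingularSystem T e f s) (x : E) :
    ‖T x‖ₑ ^ 2 = ∑' k, ENNReal.ofReal (s k) ^ 2 * ‖⟪e k, x⟫_ℂ‖ₑ ^ 2 := by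
  rw [← h.orthonormal_right.tsum_enorm_sq (h.hasSum_apply x)]
  refine tsum_congr fun k => ?_
  rw [enorm_mul, mul_pow, ← ofReal_norm, Complex.norm_real, Real.norm_of_nonneg (h.pos k).le]

theorem enorm_apply_left (h : IsSingularSystem T e f s) (k : κ) :
    ‖T (e k)‖ₑ = ENNReal.ofReal (s k) := by
  rw [h.apply_left, ← ofReal_norm, norm_smul, h.orthonormal_right.1, Complex.norm_real,
    Real.norm_of_nonneg (h.pos k).le, mul_one]

/-- Expand ‖T v_m‖² along the e_k and apply Jensen with exponent p/2 ≥ 1; the weights |⟨e_k, v_m⟩|²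
have mass at most 1 over k, and Bessel over m removes them. -/
theorem tsum_enorm_apply_rpow_le (h : IsSingularSystem T e f s) {ι : Type*} {v : ι → E}
    (hv : Orthonormal ℂ v) {p : ℝ} (hp : 2 ≤ p) :
    ∑' m, ‖T (v m)‖ₑ ^ p ≤ ∑' k, ENNReal.ofReal (s k) ^ p := by
  calc ∑' m, ‖T (v m)‖ₑ ^ p
      ≤ ∑' m, ∑' k, ENNReal.ofReal (s k) ^ p * ‖⟪e k, v m⟫_ℂ‖ₑ ^ 2 := by
        refine ENNReal.tsum_le_tsum fun m => ?_
        rw [← ENNReal.pow_two_rpow_half, h.enorm_apply_sq]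
        simp only [← ENNReal.pow_two_rpow_half (ENNReal.ofReal _) p]
        refine ENNReal.rpow_tsum_mul_le (by linarith) _ _ ?_
        refine (h.orthonormal_left.tsum_enorm_inner_sq_le _).trans ?_
        simp [enorm_sq_eq_ofReal, hv.1 m]
    _ = ∑' k, ENNReal.ofReal (s k) ^ p * ∑' m, ‖⟪e k, v m⟫_ℂ‖ₑ ^ 2 := by
        rw [ENNReal.tsum_comm]
        simp only [ENNReal.tsum_mul_left]
    _ ≤ ∑' k, ENNReal.ofReal (s k) ^ p := by
        refine ENNReal.tsum_le_tsum fun k => mul_le_of_le_one_right' ?_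
        simp only [enorm_inner_comm (e k)]
        refine (hv.tsum_enorm_inner_sq_le _).trans ?_
        simp [enorm_sq_eq_ofReal, h.orthonormal_left.1 k]

/-- For p/2 ≤ 1 Jensen reverses, so the weights must have mass at least 1 over m: the family v has
to capture each e_k completely. -/
theorem le_tsum_enorm_apply_rpow (h : IsSingularSystem T e f s) {ι : Type*} {v : ι → E}
    (hv : ∀ m, ‖v m‖ = 1) (hev : ∀ k, 1 ≤ ∑' m, ‖⟪e k, v m⟫_ℂ‖ₑ ^ 2)
    {p : ℝ} (hp0 : 0 < p) (hp : p ≤ 2) :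
    ∑' k, ENNReal.ofReal (s k) ^ p ≤ ∑' m, ‖T (v m)‖ₑ ^ p := by
  calc ∑' k, ENNReal.ofReal (s k) ^ p
      ≤ ∑' k, ENNReal.ofReal (s k) ^ p * ∑' m, ‖⟪e k, v m⟫_ℂ‖ₑ ^ 2 :=
        ENNReal.tsum_le_tsum fun k => le_mul_of_one_le_right' (hev k)
    _ = ∑' m, ∑' k, ENNReal.ofReal (s k) ^ p * ‖⟪e k, v m⟫_ℂ‖ₑ ^ 2 := by
        rw [ENNReal.tsum_comm]
        simp only [ENNReal.tsum_mul_left]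
    _ ≤ ∑' m, ‖T (v m)‖ₑ ^ p := by
        refine ENNReal.tsum_le_tsum fun m => ?_
        rw [← ENNReal.pow_two_rpow_half, h.enorm_apply_sq]
        simp only [← ENNReal.pow_two_rpow_half (ENNReal.ofReal _) p]
        refine ENNReal.tsum_rpow_mul_le (by linarith) (by linarith) _ _ ?_
        refine (h.orthonormal_left.tsum_enorm_inner_sq_le _).trans ?_
        simp [enorm_sq_eq_ofReal, hv m]

end IsSingularSystem

end SingularSystem

/-! ### Existence of the singular value decomposition. -/

section Existence

variable {E F : Type*} [NormedAddCommGroup E] [InnerProductSpace ℂ E] [CompleteSpace E]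
  [NormedAddCommGroup F] [InnerProductSpace ℂ F] [CompleteSpace F]

open ContinuousLinearMap (adjoint)

/-- The index set of the nonzero singular values, counted with multiplicity, of an operator `T`
with `T* T = K`. -/
abbrev SingularIndex (K : E →L[ℂ] E) : Type :=
  Σ r : {r : ℝ // 0 < r},
    Fin (Module.finrank ℂ (Module.End.eigenspace K.toLinearMap (((r : ℝ) ^ 2 : ℝ) : ℂ)))

/-- The e_k are eigenbases of T*T at the eigenvalues r² > 0, and f_k = r⁻¹ T e_k. Compactness is
asked of T*T only, which makes the result directly applicable to column operators. -/
theorem exists_isSingularSystem (T : E →L[ℂ] F) (hT : IsCompactOperator (adjoint T ∘L T)) :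
    ∃ (e : SingularIndex (adjoint T ∘L T) → E) (f : SingularIndex (adjoint T ∘L T) → F),
      IsSingularSystem T e f fun k => (k.1 : ℝ) := by
  set K := adjoint T ∘L T with hK
  have hKx (x : E) : K x = adjoint T (T x) := rfl
  have hsymm : (K : E →ₗ[ℂ] E).IsSymmetric := fun x y => by
    change ⟪K x, y⟫_ℂ = ⟪x, K y⟫_ℂ
    rw [hKx, hKx, ContinuousLinearMap.adjoint_inner_left, ContinuousLinearMap.adjoint_inner_right]
  have hfin (r : {r : ℝ // 0 < r}) :
      FiniteDimensional ℂ (Module.End.eigenspace K.toLinearMap (((r : ℝ) ^ 2 : ℝ) : ℂ)) :=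
    ContinuousLinearMap.finite_dimensional_eigenspace hT _
      (Complex.ofReal_ne_zero.2 (pow_pos r.2 2).ne')
  let b (r : {r : ℝ // 0 < r}) := stdOrthonormalBasis ℂ
    (Module.End.eigenspace K.toLinearMap (((r : ℝ) ^ 2 : ℝ) : ℂ))
  let e : SingularIndex K → E := fun k => (b k.1 k.2 : E)
  have heig (k : SingularIndex K) : K (e k) = (((k.1 : ℝ) ^ 2 : ℝ) : ℂ) • e k :=
    Module.End.mem_eigenspace_iff.1 (b k.1 k.2).2
  have horth : Orthonormal ℂ e := by
    have h1 := (hsymm.orthogonalFamily_eigenspaces).comp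
      (γ := {r : ℝ // 0 < r}) (f := fun r => (((r : ℝ) ^ 2 : ℝ) : ℂ)) (by
        intro r r' h
        have h2 : (r : ℝ) ^ 2 = (r' : ℝ) ^ 2 := Complex.ofReal_injective h
        exact Subtype.ext ((pow_left_inj₀ r.2.le r'.2.le two_ne_zero).1 h2))
    exact h1.orthonormal_sigma_orthonormal fun r => (b r).orthonormal
  have hpos (k : SingularIndex K) : 0 < (k.1 : ℝ) := k.1.2
  have hne (k : SingularIndex K) : ((k.1 : ℝ) : ℂ) ≠ 0 := Complex.ofReal_ne_zero.2 (hpos k).ne'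
  refine ⟨e, fun k => ((k.1 : ℝ) : ℂ)⁻¹ • T (e k), horth, ?_, hpos, ?_, ?_, ?_⟩
  · classical
    rw [orthonormal_iff_ite] at horth ⊢
    intro k l
    rw [inner_smul_left, inner_smul_right, ← ContinuousLinearMap.adjoint_inner_right, ← hKx, heig,
      inner_smul_right, horth]
    split_ifs with h
    · subst h
      have := hne k
      simp
      field_simp
    · simp
  · intro k
    rw [smul_smul, mul_inv_cancel₀ (hne k), one_smul]
  · intro k
    have := hne k
    rw [map_smul, ← hKx, heig, smul_smul]
    congr 1
    push_cast
    field_simp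
  · intro x hx
    have hsq (z : E) : ⟪K z, z⟫_ℂ = (‖T z‖ : ℂ) ^ 2 := by
      rw [hKx, ContinuousLinearMap.adjoint_inner_left, inner_self_eq_norm_sq_to_K]; rfl
    have hbot := ContinuousLinearMap.orthogonalComplement_iSup_eigenspaces_eq_bot hT hsymm
    -- The eigenspaces of K are total, so K x = 0 follows once K x is orthogonal to every
    -- eigenvector y. For μ = 0 the factor μ kills the inner product; otherwise μ = (‖T y‖ / ‖y‖)²
    -- is positive and y lies in the span of the e_k.
    have hKx0 : K x ∈ (⨆ μ, Module.End.eigenspace (K : Module.End ℂ E) μ)ᗮ := by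
      rw [← Submodule.iInf_orthogonal, Submodule.mem_iInf]
      intro μ
      rw [Submodule.mem_orthogonal]
      intro y hy
      have hy' : K y = μ • y := Module.End.mem_eigenspace_iff.1 hy
      have h1 : ⟪y, K x⟫_ℂ = (starRingEnd ℂ) μ * ⟪y, x⟫_ℂ := by
        have := hsymm y x
        change ⟪K y, x⟫_ℂ = ⟪y, K x⟫_ℂ at this
        rw [← this, hy', inner_smul_left]
      rw [h1]
      by_cases hy0 : y = 0
      · simp [hy0]
      by_cases hμ : μ = 0
      · simp [hμ]
      have hn : (‖y‖ : ℝ) ≠ 0 := norm_ne_zero_iff.2 hy0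
      have h2 : (starRingEnd ℂ) μ = (((‖T y‖ / ‖y‖) ^ 2 : ℝ) : ℂ) := by
        have := hsq y
        rw [hy', inner_smul_left, inner_self_eq_norm_sq_to_K] at this
        have hn' : (‖y‖ : ℂ) ≠ 0 := Complex.ofReal_ne_zero.2 hn
        push_cast
        rw [div_pow, eq_div_iff (pow_ne_zero 2 hn')]
        exact this
      have h3 : μ = (((‖T y‖ / ‖y‖) ^ 2 : ℝ) : ℂ) := by
        rw [← Complex.conj_conj μ, h2, Complex.conj_ofReal]
      have hr : 0 < ‖T y‖ / ‖y‖ := by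
        refine lt_of_le_of_ne (by positivity) fun h => hμ ?_
        rw [h3, ← h]; simp
      have hyx : ⟪y, x⟫_ℂ = 0 := by
        rw [h3] at hy
        have h4 := (b ⟨_, hr⟩).sum_repr' ⟨y, hy⟩
        have h5 : y = ∑ i, ⟪b ⟨_, hr⟩ i, ⟨y, hy⟩⟫_ℂ • e ⟨⟨_, hr⟩, i⟩ := by
          have := congrArg Subtype.val h4
          simpa [e] using this.symm
        rw [h5, sum_inner]
        refine Finset.sum_eq_zero fun i _ => ?_
        rw [inner_smul_left, hx, mul_zero]
      rw [hyx, mul_zero]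
    rw [hbot, Submodule.mem_bot] at hKx0
    have := hsq x
    rw [hKx0, inner_zero_left] at this
    simpa using this.symm

end Existence

/-! ### The Schatten sum in terms of the spectrum of T*T. -/

section SchattenSum

variable {H : Type*} [NormedAddCommGroup H] [InnerProductSpace ℂ H] [CompleteSpace H]

open ContinuousLinearMap (adjoint)

theorem eigenspace_abs (T : H →L[ℂ] H) {r : ℝ} (hr : 0 < r) :
    Module.End.eigenspace (CFC.abs T : H →L[ℂ] H).toLinearMap (r : ℂ) =
      Module.End.eigenspace (adjoint T ∘L T).toLinearMap ((r ^ 2 : ℝ) : ℂ) := by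
  have hmul (x : H) : CFC.abs T (CFC.abs T x) = (adjoint T ∘L T) x := 
    congrArg (fun S : H →L[ℂ] H => S x) (CFC.abs_mul_abs T)
  have hposi : (CFC.abs T : H →L[ℂ] H).IsPositive :=
    (ContinuousLinearMap.nonneg_iff_isPositive _).1 (CFC.abs_nonneg T)
  ext x
  rw [Module.End.mem_eigenspace_iff, Module.End.mem_eigenspace_iff]
  change CFC.abs T x = _ ↔ (adjoint T ∘L T) x = _
  rw [← hmul]
  constructor
  · intro h
    rw [h, map_smul, h, smul_smul]
    push_cast
    rw [sq]
  · intro h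
    -- This defect satisfies |T| y = -r y, which positivity of |T| permits only for y = 0.
    set y := CFC.abs T x - (r : ℂ) • x with hy
    have h1 : CFC.abs T y = -((r : ℂ) • y) := by
      rw [hy, map_sub, h, map_smul, smul_sub, smul_smul]
      push_cast
      rw [sq]
      abel
    have h2 := hposi.re_inner_nonneg_left y
    rw [h1, inner_neg_left, inner_smul_left, inner_self_eq_norm_sq_to_K] at h2
    have h3 : 0 ≤ -(r * ‖y‖ ^ 2) := by
      have : RCLike.re (-((starRingEnd ℂ) (r : ℂ) * (‖y‖ : ℂ) ^ 2)) = -(r * ‖y‖ ^ 2) := by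
        rw [Complex.conj_ofReal]; norm_cast
      exact this ▸ h2
    have h4 : ‖y‖ ^ 2 = 0 := by nlinarith [sq_nonneg ‖y‖, mul_nonneg hr.le (sq_nonneg ‖y‖)]
    have h5 : y = 0 := by simpa using h4
    exact sub_eq_zero.1 h5

theorem schattenSum_eq_tsum (p : ℝ) (T : H →L[ℂ] H) :
    schattenSum p T =
      ∑' k : SingularIndex (adjoint T ∘L T), ENNReal.ofReal (k.1 : ℝ) ^ p := by
  rw [ENNReal.tsum_sigma', schattenSum]
  refine tsum_congr fun r => ?_
  rw [eigenspace_abs T r.2, tsum_fintype, ← ENNReal.ofReal_rpow_of_pos r.2]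
  dsimp only
  rw [Finset.sum_const, Finset.card_fin, nsmul_eq_mul]

theorem exists_isSingularSystem_schattenSum {T : H →L[ℂ] H} (hT : IsCompactOperator T) :
    ∃ (κ : Type) (e f : κ → H) (s : κ → ℝ), IsSingularSystem T e f s ∧
      ∀ p : ℝ, schattenSum p T = ∑' k, ENNReal.ofReal (s k) ^ p := by
  obtain ⟨e, f, h⟩ := exists_isSingularSystem T (hT.clm_comp (adjoint T))
  exact ⟨_, e, f, _, h, fun p => schattenSum_eq_tsum p T⟩

end SchattenSum

/-! ### Column operators and the inequality (PP). -/

section Column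

variable {H : Type*} [NormedAddCommGroup H] [InnerProductSpace ℂ H]

open ContinuousLinearMap (adjoint)

theorem IsSingularSystem.tsum_enorm_inner_right {E F : Type*} [NormedAddCommGroup E]
    [InnerProductSpace ℂ E] [CompleteSpace E] [NormedAddCommGroup F] [InnerProductSpace ℂ F]
    [CompleteSpace F] {κ : Type*} {T : E →L[ℂ] F} {e : κ → E} {f : κ → F} {s : κ → ℝ}
    (h : IsSingularSystem T e f s) (x : E) : ∑' k, ‖⟪f k, T x⟫_ℂ‖ₑ ^ 2 = ‖T x‖ₑ ^ 2 := by
  have h1 := h.hasSum_apply x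
  rw [← h.orthonormal_right.tsum_enorm_sq h1]
  simp only [h.orthonormal_right.hasSum_coeff h1]

/-- The column operator `x ↦ (X₁ x, …, Xₙ x)`. -/
noncomputable def columnOperator {n : ℕ} (X : Fin n → H →L[ℂ] H) :
    H →L[ℂ] PiLp 2 (fun _ : Fin n => H) :=
  ((PiLp.continuousLinearEquiv 2 ℂ (fun _ : Fin n => H)).symm :
    (Fin n → H) →L[ℂ] PiLp 2 (fun _ : Fin n => H)) ∘L ContinuousLinearMap.pi X

variable {n : ℕ}

theorem columnOperator_apply (X : Fin n → H →L[ℂ] H) (x : H) (i : Fin n) :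
    columnOperator X x i = X i x := rfl

theorem inner_toLp_single (i : Fin n) (x : H) (y : PiLp 2 (fun _ : Fin n => H)) :
    ⟪WithLp.toLp 2 (Pi.single i x : Fin n → H), y⟫_ℂ = ⟪x, y i⟫_ℂ := by
  rw [PiLp.inner_apply, Finset.sum_eq_single i]
  · simp
  · intro j _ hj
    simp [Pi.single_eq_of_ne hj]
  · simp

theorem isCompactOperator_sum {ι : Type*} (s : Finset ι) (K : ι → H →L[ℂ] H)
    (h : ∀ i ∈ s, IsCompactOperator (K i)) : IsCompactOperator (∑ i ∈ s, K i : H →L[ℂ] H) :=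
  Submodule.sum_mem (compactOperator (RingHom.id ℂ) H H) h

theorem enorm_columnOperator_sq (X : Fin n → H →L[ℂ] H) (x : H) :
    ‖columnOperator X x‖ₑ ^ 2 = ∑ i, ‖X i x‖ₑ ^ 2 := by
  simp only [enorm_sq_eq_ofReal]
  rw [PiLp.norm_sq_eq_of_L2, ENNReal.ofReal_sum_of_nonneg fun _ _ => sq_nonneg _]
  rfl

theorem orthonormal_toLp_single {κ : Fin n → Type*} {f : ∀ i, κ i → H}
    (hf : ∀ i, Orthonormal ℂ (f i)) :
    Orthonormal ℂ fun a : Σ i, κ i => WithLp.toLp 2 (Pi.single a.1 (f a.1 a.2) : Fin n → H) := by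
  classical
  rw [orthonormal_iff_ite]
  rintro ⟨i, k⟩ ⟨j, l⟩
  rw [inner_toLp_single]
  by_cases hij : i = j
  · subst hij
    have := orthonormal_iff_ite.1 (hf i) k l
    simpa using this
  · simp [hij]

variable [CompleteSpace H]

theorem adjoint_columnOperator_single (X : Fin n → H →L[ℂ] H) (i : Fin n) (x : H) :
    adjoint (columnOperator X) (WithLp.toLp 2 (Pi.single i x : Fin n → H)) = adjoint (X i) x := by
  refine ext_inner_right ℂ fun y => ?_
  rw [ContinuousLinearMap.adjoint_inner_left, ContinuousLinearMap.adjoint_inner_left,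
    inner_toLp_single, columnOperator_apply]

theorem adjoint_columnOperator_comp (X : Fin n → H →L[ℂ] H) :
    adjoint (columnOperator X) ∘L columnOperator X = ∑ i, adjoint (X i) ∘L X i := by
  ext x
  refine ext_inner_right ℂ fun y => ?_
  rw [ContinuousLinearMap.comp_apply, ContinuousLinearMap.adjoint_inner_left, PiLp.inner_apply,
    sum_apply, sum_inner]
  refine Finset.sum_congr rfl fun i _ => ?_
  rw [ContinuousLinearMap.comp_apply, ContinuousLinearMap.adjoint_inner_left]
  rfl

/-- `∑ₖ σₖ ^ p`, where the `σₖ ^ 2` are the nonzero eigenvalues of `K`. -/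
noncomputable def eigenvalueSum (p : ℝ) (K : H →L[ℂ] H) : ℝ≥0∞ :=
  ∑' k : SingularIndex K, ENNReal.ofReal (k.1 : ℝ) ^ p

/-- Bounds with constant 1 test T* on the right singular vectors of the Xᵢ, placed in separate
coordinates. Bounds with a power of n test each Xᵢ on the vectors e_k of T and use σ_k^p = (∑ ‖Xᵢ
e_k‖²)^(p/2) with the power mean inequality. -/
theorem schattenSum_column_bounds {X : Fin n → H →L[ℂ] H} (hX : ∀ i, IsCompactOperator (X i))
    {p : ℝ} (hp : 0 < p) :
    (2 ≤ p → ∑ i, schattenSum p (X i) ≤ eigenvalueSum p (∑ i, adjoint (X i) ∘L X i) ∧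
      eigenvalueSum p (∑ i, adjoint (X i) ∘L X i) ≤
        (n : ℝ≥0∞) ^ (p / 2 - 1) * ∑ i, schattenSum p (X i)) ∧
    (p ≤ 2 → eigenvalueSum p (∑ i, adjoint (X i) ∘L X i) ≤ ∑ i, schattenSum p (X i) ∧
      ∑ i, schattenSum p (X i) ≤
        (n : ℝ≥0∞) ^ (1 - p / 2) * eigenvalueSum p (∑ i, adjoint (X i) ∘L X i)) := by
  rw [← adjoint_columnOperator_comp, eigenvalueSum]
  have hcomp : IsCompactOperator (adjoint (columnOperator X) ∘L columnOperator X) := by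
    rw [adjoint_columnOperator_comp]
    exact isCompactOperator_sum _ _ fun i _ => (hX i).clm_comp (adjoint (X i))
  obtain ⟨e, g, hT⟩ := exists_isSingularSystem (columnOperator X) hcomp
  choose κ u f s hs hsum using fun i => exists_isSingularSystem_schattenSum (hX i)
  set v : (Σ i, κ i) → PiLp 2 (fun _ : Fin n => H) :=
    fun a => WithLp.toLp 2 (Pi.single a.1 (f a.1 a.2) : Fin n → H) with hv
  have hvo : Orthonormal ℂ v := orthonormal_toLp_single fun i => (hs i).orthonormal_right
  have hTv (a : Σ i, κ i) :
      adjoint (columnOperator X) (v a) = (s a.1 a.2 : ℂ) • u a.1 a.2 := by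
    rw [hv, adjoint_columnOperator_single, (hs a.1).adjoint_apply_right]
  have htot : ∑ i, schattenSum p (X i) =
      ∑' a : Σ i, κ i, ‖adjoint (columnOperator X) (v a)‖ₑ ^ p := by
    rw [ENNReal.tsum_sigma', tsum_fintype]
    refine Finset.sum_congr rfl fun i _ => ?_
    rw [hsum i p]
    refine tsum_congr fun m => ?_
    rw [hv, adjoint_columnOperator_single, (hs i).adjoint.enorm_apply_left]
  have hval (k : SingularIndex (adjoint (columnOperator X) ∘L columnOperator X)) :
      ENNReal.ofReal (k.1 : ℝ) ^ p = (∑ i, ‖X i (e k)‖ₑ ^ 2) ^ (p / 2) := by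
    rw [← enorm_columnOperator_sq, ENNReal.pow_two_rpow_half, hT.enorm_apply_left]
  refine ⟨fun h2 => ⟨?_, ?_⟩, fun h2 => ⟨?_, ?_⟩⟩
  · rw [htot]
    exact hT.adjoint.tsum_enorm_apply_rpow_le hvo h2
  · calc ∑' k : SingularIndex _, ENNReal.ofReal (k.1 : ℝ) ^ p
        ≤ ∑' k, (n : ℝ≥0∞) ^ (p / 2 - 1) * ∑ i, ‖X i (e k)‖ₑ ^ p := by
          refine ENNReal.tsum_le_tsum fun k => ?_
          rw [hval]
          have := ENNReal.rpow_sum_le_const_mul_sum_rpow Finset.univ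
            (fun i => ‖X i (e k)‖ₑ ^ 2) (p := p / 2) (by linarith)
          simpa [ENNReal.pow_two_rpow_half] using this
      _ = (n : ℝ≥0∞) ^ (p / 2 - 1) * ∑ i, ∑' k, ‖X i (e k)‖ₑ ^ p := by
          rw [ENNReal.tsum_mul_left, Summable.tsum_finsetSum fun _ _ => ENNReal.summable]
      _ ≤ _ := by
          gcongr with i
          rw [hsum i p]
          exact (hs i).tsum_enorm_apply_rpow_le hT.orthonormal_left h2
  · rw [htot]
    refine hT.adjoint.le_tsum_enorm_apply_rpow hvo.1 (fun k => le_of_eq ?_) hp h2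
    -- g_k lies in the range of T, so its i-th coordinate lies in the range of Xᵢ and Parseval holds
    -- for it along the f_{i,m}.
    have hk : g k = columnOperator X (((k.1 : ℝ) : ℂ)⁻¹ • e k) := by
      rw [map_smul, hT.apply_left, smul_smul,
        inv_mul_cancel₀ (Complex.ofReal_ne_zero.2 (hT.pos k).ne'), one_smul]
    have h1 : ‖g k‖ₑ ^ 2 = 1 := by simp [enorm_sq_eq_ofReal, hT.orthonormal_right.1 k]
    rw [← h1, hk, enorm_columnOperator_sq, ENNReal.tsum_sigma', tsum_fintype]
    refine Finset.sum_congr rfl fun i _ => ?_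
    rw [← (hs i).tsum_enorm_inner_right]
    refine tsum_congr fun m => ?_
    rw [enorm_inner_comm (columnOperator X _), hv, inner_toLp_single, columnOperator_apply]
  · calc ∑ i, schattenSum p (X i)
        ≤ ∑ i, ∑' k, ‖X i (e k)‖ₑ ^ p := by
          refine Finset.sum_le_sum fun i _ => ?_
          rw [hsum i p]
          refine (hs i).le_tsum_enorm_apply_rpow hT.orthonormal_left.1 (fun m => le_of_eq ?_) hp h2
          -- u_{i,m} lies in the range of T*, so Parseval holds for it along the e_k.
          have hm : u i m = adjoint (columnOperator X) (((s i m : ℝ) : ℂ)⁻¹ • v ⟨i, m⟩) := by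
            rw [map_smul, hTv, smul_smul,
              inv_mul_cancel₀ (Complex.ofReal_ne_zero.2 ((hs i).pos m).ne'), one_smul]
          have h1 : ‖u i m‖ₑ ^ 2 = 1 := by simp [enorm_sq_eq_ofReal, (hs i).orthonormal_left.1 m]
          rw [← h1, hm, ← hT.adjoint.tsum_enorm_inner_right]
          simp only [enorm_inner_comm (e _)]
      _ = ∑' k, ∑ i, ‖X i (e k)‖ₑ ^ p := by
          rw [Summable.tsum_finsetSum fun _ _ => ENNReal.summable]
      _ ≤ ∑' k : SingularIndex _, (n : ℝ≥0∞) ^ (1 - p / 2) * ENNReal.ofReal (k.1 : ℝ) ^ p := by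
          refine ENNReal.tsum_le_tsum fun k => ?_
          rw [hval]
          have := ENNReal.sum_rpow_le_const_mul_rpow_sum Finset.univ
            (fun i => ‖X i (e k)‖ₑ ^ 2) (r := p / 2) (by linarith) (by linarith)
          simpa [ENNReal.pow_two_rpow_half] using this
      _ = _ := ENNReal.tsum_mul_left

theorem schattenNorm_rpow {p : ℝ} (hp : 0 < p) (T : H →L[ℂ] H) :
    schattenNorm p T ^ p = (schattenSum p T).toReal := by
  rw [schattenNorm, ← Real.rpow_mul ENNReal.toReal_nonneg, one_div, inv_mul_cancel₀ hp.ne',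
    Real.rpow_one]

theorem sumSquaresEq_iff {s t : ℕ} {X : Fin s → H →L[ℂ] H} {Y : Fin t → H →L[ℂ] H} :
    SumSquaresEq X Y ↔ ∑ i, adjoint (X i) ∘L X i = ∑ j, adjoint (Y j) ∘L Y j := by
  simp only [SumSquaresEq, CFC.abs_sq]
  rfl

theorem rpow_neg_mul_le_of_le_rpow_mul {a b c r : ℝ} (hc : 0 ≤ c) (hb : 0 ≤ b)
    (hca : c = 0 → a = 0) (h : a ≤ c ^ r * b) : c ^ (-r) * a ≤ b := by
  rcases hc.eq_or_lt with h0 | h0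
  · rwa [hca h0.symm, mul_zero]
  · calc c ^ (-r) * a ≤ c ^ (-r) * (c ^ r * b) := by gcongr
      _ = b := by rw [← mul_assoc, ← Real.rpow_add h0]; simp

theorem clarksonMcCarthyPP_of_sumSquaresEq {s t : ℕ} {p : ℝ} (hp : 0 < p)
    {X : Fin s → H →L[ℂ] H} {Y : Fin t → H →L[ℂ] H} (hX : ∀ i, MemSchatten p (X i))
    (hY : ∀ j, MemSchatten p (Y j)) (h : SumSquaresEq X Y) : ClarksonMcCarthyPP p X Y := by
  have bX := schattenSum_column_bounds (fun i => (hX i).1) hp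
  have bY := schattenSum_column_bounds (fun j => (hY j).1) hp
  rw [sumSquaresEq_iff.1 h] at bX
  have key {m k c : ℕ} {Z : Fin m → H →L[ℂ] H} {W : Fin k → H →L[ℂ] H} {r : ℝ}
      (hr : 0 ≤ r) (hW : ∀ j, MemSchatten p (W j))
      (hZ : ∀ j, MemSchatten p (Z j))
      (h : ∑ i, schattenSum p (Z i) ≤ (c : ℝ≥0∞) ^ r * ∑ i, schattenSum p (W i)) :
      ∑ i, schattenNorm p (Z i) ^ p ≤ (c : ℝ) ^ r * ∑ i, schattenNorm p (W i) ^ p := by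
    simp only [schattenNorm_rpow hp]
    rw [← ENNReal.toReal_sum fun i _ => (hZ i).2, ← ENNReal.toReal_sum fun i _ => (hW i).2]
    have h1 := ENNReal.toReal_mono (ENNReal.mul_ne_top (ENNReal.rpow_ne_top_of_nonneg hr
      (ENNReal.natCast_ne_top c)) (ENNReal.sum_ne_top.2 fun i _ => (hW i).2)) h
    simpa [ENNReal.toReal_mul, ← ENNReal.toReal_rpow] using h1
  have nn {m : ℕ} (Z : Fin m → H →L[ℂ] H) : 0 ≤ ∑ i, schattenNorm p (Z i) ^ p := by
    simp only [schattenNorm_rpow hp]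
    exact Finset.sum_nonneg fun _ _ => ENNReal.toReal_nonneg
  have emp {m : ℕ} (Z : Fin m → H →L[ℂ] H) (h : (m : ℝ) = 0) :
      ∑ i, schattenNorm p (Z i) ^ p = 0 := by
    have h0 : m = 0 := by exact_mod_cast h
    subst h0
    simp
  refine ⟨fun h2 => ⟨?_, ?_⟩, fun h2 => ⟨?_, ?_⟩⟩
  · have h1 := key (by linarith) hX hY (((bY.1 h2).1).trans (bX.1 h2).2)
    rw [← neg_sub]
    -- For s = 0 the constant cannot be inverted; there X is empty and `h1` forces the sum over Y to
    -- vanish.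
    refine rpow_neg_mul_le_of_le_rpow_mul (Nat.cast_nonneg s) (nn X) (fun h0 => ?_) h1
    rw [emp X h0, mul_zero] at h1
    exact le_antisymm h1 (nn Y)
  · exact key (by linarith) hY hX (((bX.1 h2).1).trans (bY.1 h2).2)
  · rw [← neg_sub]
    refine rpow_neg_mul_le_of_le_rpow_mul (Nat.cast_nonneg t) (nn X) (emp Y)
      (key (sub_nonneg.2 (by linarith)) hX hY (((bY.2 h2).2).trans ?_))
    gcongr
    exact (bX.2 h2).1
  · refine key (sub_nonneg.2 (by linarith)) hY hX (((bX.2 h2).2).trans ?_)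
    gcongr
    exact (bY.2 h2).1

end Column

/-! ### Interpolation of bilinear forms in mixed ℓ^p norms, and duality. -/

section Interpolation

open Complex.HadamardThreeLines

/-- A Riesz–Thorin argument with values in a mixed norm, ℓ^p over ι of ℓ^q over the fibers of π. -/
theorem norm_bilinear_le_interp {α β ι : Type*} [Fintype α] [Fintype β] [Fintype ι] [DecidableEq ι]
    (π : β → ι) (B : β → α → ℂ) {M p q : ℝ} (hM : 0 < M) (hp : p ≤ 2) (hpq : p.HolderConjugate q)
    (h1 : ∀ (u : α → ℂ) (w : β → ℂ) (c : ι → ℝ), (∀ i, 0 ≤ c i) → (∀ b, ‖w b‖ ≤ c (π b)) →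
      ‖∑ b, ∑ a, B b a * u a * w b‖ ≤ M * (∑ a, ‖u a‖) * ∑ i, c i)
    (h2 : ∀ (u : α → ℂ) (w : β → ℂ), ‖∑ b, ∑ a, B b a * u a * w b‖ ≤
      Real.sqrt (∑ a, ‖u a‖ ^ 2) * Real.sqrt (∑ b, ‖w b‖ ^ 2))
    {s : α → ℝ} {σ : β → ℝ} (hs : ∀ a, 0 < s a) (hσ : ∀ b, 0 < σ b) :
    ‖∑ b, ∑ a, B b a * s a * σ b‖ ≤ M ^ (2 / p - 1) * (∑ a, s a ^ p) ^ (1 / p) *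
      (∑ i, (∑ b with π b = i, σ b ^ q) ^ (p / q)) ^ (1 / p) := by
  have hp0 := hpq.pos
  have hq0 := hpq.symm.pos
  set N : ι → ℝ := fun i => (∑ b with π b = i, σ b ^ q) ^ (1 / q) with hN
  have hsum0 (i : ι) : 0 ≤ ∑ b with π b = i, σ b ^ q :=
    Finset.sum_nonneg fun b _ => Real.rpow_nonneg (hσ b).le q
  have hN0 (i : ι) : 0 ≤ N i := Real.rpow_nonneg (hsum0 i) _
  have hNpos (b : β) : 0 < N (π b) :=
    Real.rpow_pos_of_pos (Finset.sum_pos (fun b _ => Real.rpow_pos_of_pos (hσ b) q)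
      ⟨b, by simp⟩) _
  have hNp (i : ι) : (∑ b with π b = i, σ b ^ q) ^ (p / q) = N i ^ p := by
    rw [hN, ← Real.rpow_mul (hsum0 i)]
    congr 1
    ring
  have hNq (i : ι) : ∑ b with π b = i, σ b ^ q = N i ^ q := by
    rw [hN, ← Real.rpow_mul (hsum0 i), one_div, inv_mul_cancel₀ hq0.ne', Real.rpow_one]
  simp only [hNp]
  set S := ∑ a, s a ^ p with hS
  set W := ∑ i, N i ^ p with hW
  have hS0 : 0 ≤ S := Finset.sum_nonneg fun a _ => Real.rpow_nonneg (hs a).le p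
  have hW0 : 0 ≤ W := Finset.sum_nonneg fun i _ => Real.rpow_nonneg (hN0 i) p
  -- The exponents are affine in z and satisfy three conditions: at z = 2/q the original vectors
  -- return, on Re z = 0 the moduli are s^p and N^p, and on Re z = 1 the squared moduli sum to S and
  -- W.
  let u : ℂ → α → ℂ := fun z a => (s a : ℂ) ^ ((p : ℂ) * (1 - z / 2))
  let w : ℂ → β → ℂ := fun z b =>
    (N (π b) : ℂ) ^ ((p : ℂ) - z * ((p + q) / 2)) * (σ b : ℂ) ^ ((q : ℂ) * z / 2)
  let f : ℂ → ℂ := fun z => ∑ b, ∑ a, B b a * u z a * w z b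
  have hu (z : ℂ) (a : α) : ‖u z a‖ = s a ^ (p * (1 - z.re / 2)) := by
    rw [Complex.norm_cpow_eq_rpow_re_of_pos (hs a)]
    simp
  have hw (z : ℂ) (b : β) :
      ‖w z b‖ = N (π b) ^ (p - z.re * ((p + q) / 2)) * σ b ^ (q * z.re / 2) := by
    rw [norm_mul, Complex.norm_cpow_eq_rpow_re_of_pos (hNpos b),
      Complex.norm_cpow_eq_rpow_re_of_pos (hσ b)]
    congr 2
    · simp
    · simp
  have hdiff : Differentiable ℂ f := by
    refine Differentiable.fun_sum fun b _ => Differentiable.fun_sum fun a _ => ?_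
    have e1 : (s a : ℂ) ≠ 0 := Complex.ofReal_ne_zero.2 (hs a).ne'
    have e2 : (N (π b) : ℂ) ≠ 0 := Complex.ofReal_ne_zero.2 (hNpos b).ne'
    have e3 : (σ b : ℂ) ≠ 0 := Complex.ofReal_ne_zero.2 (hσ b).ne'
    refine Differentiable.mul (Differentiable.mul (differentiable_const _) ?_)
      (Differentiable.mul ?_ ?_)
    · exact Differentiable.const_cpow (by fun_prop) (Or.inl e1)
    · exact Differentiable.const_cpow (by fun_prop) (Or.inl e2)
    · exact Differentiable.const_cpow (by fun_prop) (Or.inl e3)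
  let g : ℝ → ℝ := fun x => ∑ b, ∑ a, ‖B b a‖ * s a ^ (p * (1 - x / 2)) *
    (N (π b) ^ (p - x * ((p + q) / 2)) * σ b ^ (q * x / 2))
  have hg : Continuous g := by
    refine continuous_finsetSum _ fun b _ => continuous_finsetSum _ fun a _ => ?_
    refine Continuous.mul (Continuous.mul continuous_const ?_) (Continuous.mul ?_ ?_)
    · exact Continuous.rpow continuous_const (by fun_prop) fun _ => Or.inl (hs a).ne'
    · exact Continuous.rpow continuous_const (by fun_prop) fun _ => Or.inl (hNpos b).ne'
    · exact Continuous.rpow continuous_const (by fun_prop) fun _ => Or.inl (hσ b).ne'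
  have hfg (z : ℂ) : ‖f z‖ ≤ g z.re := by
    refine (norm_sum_le _ _).trans (Finset.sum_le_sum fun b _ => (norm_sum_le _ _).trans
      (Finset.sum_le_sum fun a _ => ?_))
    rw [norm_mul, norm_mul, hu, hw]
  have hbdd : BddAbove ((norm ∘ f) '' verticalClosedStrip 0 1) := by
    obtain ⟨C, hC⟩ := (isCompact_Icc (a := (0 : ℝ)) (b := 1)).bddAbove_image hg.continuousOn
    refine ⟨C, ?_⟩
    rintro _ ⟨z, hz, rfl⟩
    exact (hfg z).trans (hC ⟨z.re, hz, rfl⟩)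
  have line0 : ∀ z ∈ Complex.re ⁻¹' {0}, ‖f z‖ ≤ M * S * W := by
    intro z hz
    have hz0 : z.re = 0 := hz
    refine (h1 (u z) (w z) (fun i => N i ^ p) (fun i => Real.rpow_nonneg (hN0 i) p) ?_).trans
      (le_of_eq ?_)
    · intro b
      rw [hw, hz0]
      simp
    · simp only [hu, hz0]
      simp [hS, hW]
  have line1 : ∀ z ∈ Complex.re ⁻¹' {1}, ‖f z‖ ≤ Real.sqrt (S * W) := by
    intro z hz
    have hz1 : z.re = 1 := hz
    refine (h2 (u z) (w z)).trans (le_of_eq ?_)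
    rw [Real.sqrt_mul hS0]
    congr 2
    · refine Finset.sum_congr rfl fun a _ => ?_
      rw [hu, hz1, ← Real.rpow_natCast, ← Real.rpow_mul (hs a).le]
      congr 1
      push_cast
      ring
    · rw [← Finset.sum_fiberwise Finset.univ π, hW]
      refine Finset.sum_congr rfl fun i _ => ?_
      have : ∀ b ∈ Finset.univ.filter (fun b => π b = i),
          ‖w z b‖ ^ 2 = N i ^ (p - q) * σ b ^ q := by
        intro b hb
        rw [Finset.mem_filter] at hb
        rw [hw, hz1, mul_pow, ← Real.rpow_natCast, ← Real.rpow_natCast,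
          ← Real.rpow_mul (hNpos b).le, ← Real.rpow_mul (hσ b).le, hb.2]
        congr 2 <;> push_cast <;> ring
      rw [Finset.sum_congr rfl this, ← Finset.mul_sum, hNq]
      rcases (hN0 i).eq_or_lt with h | h
      · rw [← h, Real.zero_rpow hq0.ne', Real.zero_rpow hp0.ne', mul_zero]
      · rw [← Real.rpow_add h, sub_add_cancel]
  set θ : ℝ := 2 / q with hθ
  have hinv := hpq.inv_add_inv_eq_one
  have hqi : 1 / q = 1 - 1 / p := by simp only [one_div]; linarith
  have hθ' : θ = 2 - 2 / p := by
    rw [hθ, div_eq_mul_one_div, hqi]; ring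
  have hpi : 1 / 2 ≤ 1 / p := one_div_le_one_div_of_le hp0 hp
  have hθ1 : θ ≤ 1 := by
    rw [hθ', div_eq_mul_one_div 2 p]; linarith
  have hθ0 : 0 ≤ θ := by positivity
  have hmem : (θ : ℂ) ∈ verticalClosedStrip 0 1 := by
    change (θ : ℂ).re ∈ Set.Icc (0 : ℝ) 1
    exact ⟨hθ0, hθ1⟩
  have key := norm_le_interp_of_mem_verticalClosedStrip₀₁' f hmem hdiff.diffContOnCl hbdd line0 line1
  have hf : f θ = ∑ b, ∑ a, B b a * s a * σ b := by
    refine Finset.sum_congr rfl fun b _ => Finset.sum_congr rfl fun a _ => ?_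
    have x1 : (p : ℂ) * (1 - (θ : ℂ) / 2) = 1 := by
      have : p * (1 - θ / 2) = 1 := by rw [hθ']; field_simp; ring
      exact_mod_cast this
    have x2 : (p : ℂ) - (θ : ℂ) * ((p + q) / 2) = 0 := by
      have : p - θ * ((p + q) / 2) = 0 := by
        have := hpq.mul_eq_add
        rw [hθ]; field_simp; linarith
      exact_mod_cast this
    have x3 : (q : ℂ) * (θ : ℂ) / 2 = 1 := by
      have : q * θ / 2 = 1 := by rw [hθ]; field_simp
      exact_mod_cast this
    simp only [u, w, x1, x2, x3, Complex.cpow_one, Complex.cpow_zero, one_mul]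
  rw [hf, Complex.ofReal_re] at key
  refine key.trans (le_of_eq ?_)
  rw [Real.sqrt_eq_rpow, ← Real.rpow_mul (by positivity), mul_assoc,
    Real.mul_rpow hM.le (by positivity), mul_assoc, mul_assoc, ← Real.mul_rpow hS0 hW0]
  congr 1
  · congr 1
    rw [hθ']; ring
  · rcases (mul_nonneg hS0 hW0).eq_or_lt with h | h
    · have hne : 1 / 2 * θ ≠ 0 := by positivity
      rw [← h, Real.zero_rpow hne, Real.zero_rpow (one_div_ne_zero hp0.ne'), mul_zero]
    · rw [← Real.rpow_add h]
      congr 1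
      rw [hθ']; ring

/-- The interpolated bound for all finite sections of the matrix `B`. -/
def FiniteSectionBound {α β ι : Type*} [Fintype ι] [DecidableEq ι] (π : β → ι) (B : β → α → ℂ)
    (C p q : ℝ) : Prop :=
  ∀ (F : Finset α) (G : Finset β) (u : α → ℝ) (w : β → ℝ), (∀ a ∈ F, 0 < u a) →
    (∀ b ∈ G, 0 < w b) →
    ‖∑ b ∈ G, ∑ a ∈ F, B b a * u a * w b‖ ≤ C * (∑ a ∈ F, u a ^ p) ^ (1 / p) *
      (∑ i, (∑ b ∈ G with π b = i, w b ^ q) ^ (p / q)) ^ (1 / p)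

theorem le_rpow_of_le_mul_rpow {D K p q : ℝ} (hpq : p.HolderConjugate q) (hD : 0 ≤ D)
    (hK : 0 ≤ K) (h : D ≤ K * D ^ (1 / p)) : D ≤ K ^ q := by
  rcases hD.eq_or_lt with h0 | h0
  · rw [← h0]; positivity
  · have hinv := hpq.inv_add_inv_eq_one
    have h1 : D = D ^ (1 / q) * D ^ (1 / p) := by
      rw [← Real.rpow_add h0, one_div, one_div, add_comm, hinv, Real.rpow_one]
    have h2 : D ^ (1 / q) ≤ K := by
      refine le_of_mul_le_mul_right ?_ (Real.rpow_pos_of_pos h0 (1 / p))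
      rwa [← h1]
    calc D = (D ^ (1 / q)) ^ q := by
          rw [← Real.rpow_mul hD, one_div, inv_mul_cancel₀ hpq.symm.pos.ne', Real.rpow_one]
      _ ≤ K ^ q := Real.rpow_le_rpow (by positivity) h2 hpq.symm.pos.le

section Limits

open Filter Topology

variable {α β ι : Type*} [Fintype ι] [DecidableEq ι] {π : β → ι} {B : β → α → ℂ} {C p q : ℝ}
  {s : α → ℝ} {x : β → ℝ}

/-- Duality: the relation x = Bs is tested against a vector that is extremal for the mixed norm. The
limit over F is taken for fixed G, and the limit over G at the end. -/
theorem FiniteSectionBound.sum_rpow_le (hB : FiniteSectionBound π B C p q) (hC : 0 ≤ C)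
    (hpq : p.HolderConjugate q) (hs : ∀ a, 0 < s a) (hx : ∀ b, 0 < x b)
    (hsum : ∀ b, HasSum (fun a => B b a * s a) (x b : ℂ)) {S : ℝ}
    (hS : HasSum (fun a => s a ^ p) S) {n : ι → ℝ}
    (hn : ∀ i, HasSum (fun b => if π b = i then x b ^ p else 0) (n i)) :
    ∑ i, n i ^ (q / p) ≤ C ^ q * S ^ (q / p) := by
  have hp0 := hpq.pos
  have hq0 := hpq.symm.pos
  have hS0 : 0 ≤ S := hS.nonneg fun a => Real.rpow_nonneg (hs a).le p
  have hexp : p * q = p + q := hpq.mul_eq_add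
  have fin (G : Finset β) :
      ∑ i, (∑ b ∈ G, if π b = i then x b ^ p else 0) ^ (q / p) ≤ C ^ q * S ^ (q / p) := by
    set m : ι → ℝ := fun i => ∑ b ∈ G, if π b = i then x b ^ p else 0 with hm
    have hm' (i : ι) : ∑ b ∈ G with π b = i, x b ^ p = m i := Finset.sum_filter _ _
    have hm0 (i : ι) : 0 ≤ m i := by
      rw [← hm']
      exact Finset.sum_nonneg fun b _ => Real.rpow_nonneg (hx b).le p
    have hmpos {b : β} (hb : b ∈ G) : 0 < m (π b) := by
      rw [← hm']
      exact Finset.sum_pos (fun b _ => Real.rpow_pos_of_pos (hx b) p) ⟨b, by simp [hb]⟩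
    -- Extremal vector: its pairing with x and the p-th power of its mixed norm are both D, so D ≤ C
    -- S^(1/p) D^(1/p).
    let w : β → ℝ := fun b => x b ^ (p - 1) * m (π b) ^ ((q - p) / p)
    set D := ∑ i, m i ^ (q / p) with hD
    have hD0 : 0 ≤ D := Finset.sum_nonneg fun i _ => Real.rpow_nonneg (hm0 i) _
    -- Fibers with m i = 0 contain no point of G, so identities need checking only where m i can be
    -- raised to negative powers.
    have hfib (φ : β → ℝ) (ψ : ι → ℝ)
        (h : ∀ i, 0 < m i → ∑ b ∈ G with π b = i, φ b = ψ i)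
        (h0 : ∀ i, m i = 0 → ψ i = 0) : ∀ i, ∑ b ∈ G with π b = i, φ b = ψ i := by
      intro i
      rcases (hm0 i).eq_or_lt with hi | hi
      · rw [h0 i hi.symm]
        refine Finset.sum_eq_zero fun b hb => ?_
        rw [Finset.mem_filter] at hb
        have := hmpos hb.1
        rw [hb.2, ← hi] at this
        exact absurd this (lt_irrefl 0)
      · exact h i hi
    have hxw : ∑ b ∈ G, x b * w b = D := by
      rw [← Finset.sum_fiberwise G π, hD]
      refine Finset.sum_congr rfl fun i _ => hfib _ (fun i => m i ^ (q / p)) (fun i hi => ?_)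
        (fun i hi => ?_) i
      · have : ∀ b ∈ G.filter (fun b => π b = i), x b * w b = m i ^ ((q - p) / p) * x b ^ p := by
          intro b hb
          rw [Finset.mem_filter] at hb
          have e1 : x b ^ p = x b * x b ^ (p - 1) := by
            rw [Real.rpow_sub_one (hx b).ne', mul_div_cancel₀ _ (hx b).ne']
          simp only [w]
          rw [e1, hb.2]
          ring
        rw [Finset.sum_congr rfl this, ← Finset.mul_sum, hm', ← Real.rpow_add_one hi.ne']
        congr 1
        field_simp
        ring
      · rw [hi, Real.zero_rpow (div_pos hq0 hp0).ne']
    have hwq : ∑ i, (∑ b ∈ G with π b = i, w b ^ q) ^ (p / q) = D := by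
      rw [hD]
      refine Finset.sum_congr rfl fun i _ => ?_
      have := hfib (fun b => w b ^ q) (fun i => m i ^ (q * q / (p * p))) (fun i hi => ?_)
        (fun i hi => ?_) i
      · rw [this, ← Real.rpow_mul (hm0 i)]
        congr 1
        field_simp
      · have : ∀ b ∈ G.filter (fun b => π b = i),
            w b ^ q = m i ^ ((q - p) / p * q) * x b ^ p := by
          intro b hb
          rw [Finset.mem_filter] at hb
          simp only [w]
          rw [Real.mul_rpow (Real.rpow_nonneg (hx b).le _) (Real.rpow_nonneg (hm0 _) _),
            ← Real.rpow_mul (hx b).le, ← Real.rpow_mul (hm0 _), hb.2, mul_comm]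
          congr 2
          linarith
        rw [Finset.sum_congr rfl this, ← Finset.mul_sum, hm', ← Real.rpow_add_one hi.ne']
        congr 1
        field_simp
        nlinarith
      · rw [hi, Real.zero_rpow (by positivity)]
    have hwpos : ∀ b ∈ G, 0 < w b := fun b hb =>
      mul_pos (Real.rpow_pos_of_pos (hx b) _) (Real.rpow_pos_of_pos (hmpos hb) _)
    have hlim : HasSum (fun a => ∑ b ∈ G, B b a * s a * w b) (∑ b ∈ G, (x b : ℂ) * w b) :=
      hasSum_sum fun b _ => (hsum b).mul_right _
    have hle : ∀ F : Finset α, ‖∑ a ∈ F, ∑ b ∈ G, B b a * s a * w b‖ ≤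
        C * S ^ (1 / p) * D ^ (1 / p) := by
      intro F
      rw [Finset.sum_comm]
      refine (hB F G s w (fun a _ => hs a) hwpos).trans ?_
      rw [hwq]
      gcongr
      · exact Finset.sum_nonneg fun a _ => Real.rpow_nonneg (hs a).le p
      · exact sum_le_hasSum F (fun a _ => Real.rpow_nonneg (hs a).le p) hS
    have h1 : ‖∑ b ∈ G, (x b : ℂ) * w b‖ ≤ C * S ^ (1 / p) * D ^ (1 / p) :=
      le_of_tendsto (Tendsto.norm hlim) (Eventually.of_forall hle)
    have h2 : ∑ b ∈ G, (x b : ℂ) * w b = (D : ℂ) := by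
      rw [← hxw]; push_cast; rfl
    rw [h2, Complex.norm_real, Real.norm_of_nonneg hD0] at h1
    refine (le_rpow_of_le_mul_rpow hpq hD0 (by positivity) h1).trans (le_of_eq ?_)
    rw [Real.mul_rpow hC (by positivity), ← Real.rpow_mul hS0]
    congr 2
    ring
  have hlim : Tendsto (fun G : Finset β =>
      ∑ i, (∑ b ∈ G, if π b = i then x b ^ p else 0) ^ (q / p)) atTop
      (𝓝 (∑ i, n i ^ (q / p))) :=
    tendsto_finsetSum _ fun i _ => (hn i).rpow_const (Or.inr (div_pos hq0 hp0).le)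
  exact le_of_tendsto hlim (Eventually.of_forall fin)

/-- The transposed relation s = Bᵀx needs only the ℓ^p extremal vector s^(q-1), because the mixed
norm now falls on x itself. -/
theorem FiniteSectionBound.le_rpow_sum (hB : FiniteSectionBound π B C p q) (hC : 0 ≤ C)
    (hpq : p.HolderConjugate q) (hs : ∀ a, 0 < s a) (hx : ∀ b, 0 < x b)
    (hsum : ∀ a, HasSum (fun b => B b a * x b) (s a : ℂ)) {S : ℝ}
    (hS : HasSum (fun a => s a ^ q) S) {n : ι → ℝ}
    (hn : ∀ i, HasSum (fun b => if π b = i then x b ^ q else 0) (n i)) :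
    S ≤ C ^ q * (∑ i, n i ^ (p / q)) ^ (q / p) := by
  have hp0 := hpq.pos
  have hq0 := hpq.symm.pos
  have hexp : p * q = p + q := hpq.mul_eq_add
  have hterm (i : ι) (b : β) : 0 ≤ if π b = i then x b ^ q else 0 := by
    split_ifs
    exacts [Real.rpow_nonneg (hx b).le q, le_rfl]
  have hn0 (i : ι) : 0 ≤ n i := (hn i).nonneg (hterm i)
  set W := ∑ i, n i ^ (p / q) with hW
  have hW0 : 0 ≤ W := Finset.sum_nonneg fun i _ => Real.rpow_nonneg (hn0 i) _
  refine le_of_tendsto hS (Eventually.of_forall fun F => ?_)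
  set D := ∑ a ∈ F, s a ^ q with hD
  have hD0 : 0 ≤ D := Finset.sum_nonneg fun a _ => Real.rpow_nonneg (hs a).le q
  let u : α → ℝ := fun a => s a ^ (q - 1)
  have hu (a : α) : u a ^ p = s a ^ q := by
    rw [← Real.rpow_mul (hs a).le]
    congr 1
    linarith
  have hsu (a : α) : s a * u a = s a ^ q := by
    simp only [u]
    rw [Real.rpow_sub_one (hs a).ne', mul_div_cancel₀ _ (hs a).ne']
  have hlim : HasSum (fun b => ∑ a ∈ F, B b a * x b * u a) (∑ a ∈ F, (s a : ℂ) * u a) :=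
    hasSum_sum fun a _ => (hsum a).mul_right _
  have hle : ∀ G : Finset β, ‖∑ b ∈ G, ∑ a ∈ F, B b a * x b * u a‖ ≤
      C * W ^ (1 / p) * D ^ (1 / p) := by
    intro G
    have h1 := hB F G u x (fun a _ => Real.rpow_pos_of_pos (hs a) _) (fun b _ => hx b)
    simp only [hu] at h1
    rw [mul_right_comm]
    simp only [mul_right_comm (B _ _) ((x _ : ℝ) : ℂ)]
    refine h1.trans ?_
    gcongr
    · exact Finset.sum_nonneg fun i _ => Real.rpow_nonneg
        (Finset.sum_nonneg fun b _ => Real.rpow_nonneg (hx b).le _) _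
    · refine Finset.sum_le_sum fun i _ => Real.rpow_le_rpow
        (Finset.sum_nonneg fun b _ => Real.rpow_nonneg (hx b).le _) ?_ (by positivity)
      rw [Finset.sum_filter]
      exact sum_le_hasSum G (fun b _ => hterm i b) (hn i)
  have h1 : ‖∑ a ∈ F, (s a : ℂ) * u a‖ ≤ C * W ^ (1 / p) * D ^ (1 / p) :=
    le_of_tendsto (Tendsto.norm hlim) (Eventually.of_forall hle)
  have h2 : ∑ a ∈ F, (s a : ℂ) * u a = (D : ℂ) := by
    rw [hD]
    simp only [← hsu]
    push_cast
    rfl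
  rw [h2, Complex.norm_real, Real.norm_of_nonneg hD0] at h1
  refine (le_rpow_of_le_mul_rpow hpq hD0 (by positivity) h1).trans (le_of_eq ?_)
  rw [Real.mul_rpow hC (by positivity), ← Real.rpow_mul hW0]
  congr 2
  ring

end Limits

end Interpolation

/-! ### Subunitary matrices acting on tuples. -/

section Subunitary

variable {H : Type*} [NormedAddCommGroup H] [InnerProductSpace ℂ H] {s t : ℕ}
  {A : Matrix (Fin s) (Fin t) ℂ}

theorem IsSubunitary.sum_conj_mul (hA : IsSubunitary A) (j k : Fin t) :
    ∑ i, (starRingEnd ℂ) (A i j) * A i k = if j = k then 1 else 0 := by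
  have h := congrFun (congrFun hA j) k
  rwa [Matrix.mul_apply, Matrix.one_apply] at h

theorem IsSubunitary.sum_inner (hA : IsSubunitary A) (v w : Fin t → H) :
    ∑ i, ⟪∑ j, A i j • v j, ∑ j, A i j • w j⟫_ℂ = ∑ j, ⟪v j, w j⟫_ℂ := by
  calc ∑ i, ⟪∑ j, A i j • v j, ∑ j, A i j • w j⟫_ℂ
      = ∑ i, ∑ j, ∑ k, ((starRingEnd ℂ) (A i j) * A i k) * ⟪v j, w k⟫_ℂ := by
        refine Finset.sum_congr rfl fun i _ => ?_
        rw [_root_.sum_inner]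
        refine Finset.sum_congr rfl fun j _ => ?_
        rw [_root_.inner_sum]
        refine Finset.sum_congr rfl fun k _ => ?_
        rw [inner_smul_left, inner_smul_right, mul_assoc]
    _ = ∑ j, ∑ k, (∑ i, (starRingEnd ℂ) (A i j) * A i k) * ⟪v j, w k⟫_ℂ := by
        rw [Finset.sum_comm]
        refine Finset.sum_congr rfl fun j _ => ?_
        rw [Finset.sum_comm]
        simp only [Finset.sum_mul]
    _ = ∑ j, ⟪v j, w j⟫_ℂ := by
        simp [hA.sum_conj_mul]

theorem IsSubunitary.sum_norm_sq (hA : IsSubunitary A) (v : Fin t → H) :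
    ∑ i, ‖∑ j, A i j • v j‖ ^ 2 = ∑ j, ‖v j‖ ^ 2 := by
  have h := hA.sum_inner v v
  simp only [inner_self_eq_norm_sq_to_K] at h
  exact_mod_cast h

theorem IsSubunitary.norm_sum_inner_le (hA : IsSubunitary A) (w : Fin s → H) (v : Fin t → H) :
    ‖∑ i, ∑ j, A i j * ⟪w i, v j⟫_ℂ‖ ≤ √(∑ j, ‖v j‖ ^ 2) * √(∑ i, ‖w i‖ ^ 2) := by
  calc ‖∑ i, ∑ j, A i j * ⟪w i, v j⟫_ℂ‖
      = ‖∑ i, ⟪w i, ∑ j, A i j • v j⟫_ℂ‖ := by simp only [inner_sum, inner_smul_right]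
    _ ≤ ∑ i, ‖∑ j, A i j • v j‖ * ‖w i‖ :=
        (norm_sum_le _ _).trans (Finset.sum_le_sum fun i _ =>
          (norm_inner_le_norm _ _).trans_eq (mul_comm _ _))
    _ ≤ √(∑ i, ‖∑ j, A i j • v j‖ ^ 2) * √(∑ i, ‖w i‖ ^ 2) := Real.sum_mul_le_sqrt_mul_sqrt _ _ _
    _ = _ := by rw [hA.sum_norm_sq]

theorem IsSubunitary.sumSquaresEq [CompleteSpace H] (hA : IsSubunitary A)
    (Y : Fin t → H →L[ℂ] H) : SumSquaresEq (matrixAct A Y) Y := by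
  rw [sumSquaresEq_iff]
  ext x
  refine ext_inner_right ℂ fun y => ?_
  simp only [sum_apply, _root_.sum_inner, ContinuousLinearMap.comp_apply,
    ContinuousLinearMap.adjoint_inner_left]
  simp only [matrixAct, sum_apply, smul_apply]
  exact hA.sum_inner (fun j => Y j x) (fun j => Y j y)

theorem IsSubunitary.matrixAct_conjTranspose (hA : IsSubunitary A) (Y : Fin t → H →L[ℂ] H) :
    matrixAct Aᴴ (matrixAct A Y) = Y := by
  funext j
  simp only [matrixAct, Finset.smul_sum, smul_smul]
  rw [Finset.sum_comm]
  simp only [← Finset.sum_smul, Matrix.conjTranspose_apply]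
  simp [hA.sum_conj_mul j]

end Subunitary

/-! ### Endpoint bounds for the matrix of A in singular coordinates. -/

section FiberOrthonormal

variable {H : Type*} [NormedAddCommGroup H] [InnerProductSpace ℂ H]

/-- The restriction of `f` to every fiber of `π` is orthonormal. -/
def FiberOrthonormal {α ι : Type*} (π : α → ι) (f : α → H) : Prop :=
  (∀ a, ‖f a‖ = 1) ∧ ∀ a b, π a = π b → a ≠ b → ⟪f a, f b⟫_ℂ = 0

namespace FiberOrthonormal

variable {α ι : Type*} {π : α → ι} {f : α → H}

theorem comp {β : Type*} (h : FiberOrthonormal π f) {g : β → α} (hg : Function.Injective g) :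
    FiberOrthonormal (π ∘ g) (f ∘ g) :=
  ⟨fun b => h.1 (g b), fun _ _ hab hne => h.2 _ _ hab (hg.ne hne)⟩

theorem sigma {κ : ι → Type*} {f : ∀ i, κ i → H} (h : ∀ i, Orthonormal ℂ (f i)) :
    FiberOrthonormal (Sigma.fst : (Σ i, κ i) → ι) fun a => f a.1 a.2 := by
  refine ⟨fun a => (h a.1).1 a.2, ?_⟩
  rintro ⟨i, k⟩ ⟨j, l⟩ hij hne
  obtain rfl : i = j := hij
  exact (h i).2 fun hkl => hne (Sigma.ext rfl (heq_of_eq hkl))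

theorem orthonormal (h : FiberOrthonormal π f) (i : ι) :
    Orthonormal ℂ fun a : {a // π a = i} => f a :=
  ⟨fun a => h.1 a, fun a b hab => h.2 _ _ (a.2.trans b.2.symm) fun he => hab (Subtype.ext he)⟩

variable [Fintype α] [DecidableEq ι]

theorem sum_norm_inner_sq_le (h : FiberOrthonormal π f) (i : ι) (x : H) :
    ∑ a with π a = i, ‖⟪f a, x⟫_ℂ‖ ^ 2 ≤ ‖x‖ ^ 2 := by
  rw [Finset.sum_subtype (Finset.univ.filter fun a => π a = i) (p := fun a => π a = i) (by simp)
    fun a => ‖⟪f a, x⟫_ℂ‖ ^ 2]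
  exact (h.orthonormal i).sum_inner_products_le (s := Finset.univ) x

theorem norm_sum_sq (h : FiberOrthonormal π f) (i : ι) (c : α → ℂ) :
    ‖∑ a with π a = i, c a • f a‖ ^ 2 = ∑ a with π a = i, ‖c a‖ ^ 2 := by
  rw [Finset.sum_subtype (Finset.univ.filter fun a => π a = i) (p := fun a => π a = i) (by simp)
    fun a => ‖c a‖ ^ 2, Finset.sum_subtype (Finset.univ.filter fun a => π a = i)
    (p := fun a => π a = i) (by simp) fun a => c a • f a]
  exact ((h.orthonormal i).hasSum_norm_sq (hasSum_fintype _)).unique (hasSum_fintype _)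

end FiberOrthonormal

variable {s t : ℕ} {A : Matrix (Fin s) (Fin t) ℂ} {α β : Type*} {πα : α → Fin t} {πβ : β → Fin s}
  {e f : α → H} {g h : β → H}

/-- The matrix of `Y ↦ A Y` in singular coordinates. -/
noncomputable def singularMatrix (A : Matrix (Fin s) (Fin t) ℂ) (πα : α → Fin t) (πβ : β → Fin s)
    (e f : α → H) (g h : β → H) (b : β) (a : α) : ℂ :=
  A (πβ b) (πα a) * ⟪h b, f a⟫_ℂ * ⟪e a, g b⟫_ℂ

variable [Fintype α] [Fintype β]

/-- For fixed a and i, AM–GM and two Bessel inequalities give ∑ |⟨h_b, f_a⟩| |⟨e_a, g_b⟩| ≤ 1 over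
the fiber of i. -/
theorem norm_singularMatrix_le_max {M : ℝ} (hM : ∀ i j, ‖A i j‖ ≤ M)
    (he : ∀ a, ‖e a‖ = 1) (hf : ∀ a, ‖f a‖ = 1) (hg : FiberOrthonormal πβ g)
    (hh : FiberOrthonormal πβ h) (u : α → ℂ) (w : β → ℂ) (c : Fin s → ℝ) (hc : ∀ i, 0 ≤ c i)
    (hw : ∀ b, ‖w b‖ ≤ c (πβ b)) :
    ‖∑ b, ∑ a, singularMatrix A πα πβ e f g h b a * u a * w b‖ ≤
      M * (∑ a, ‖u a‖) * ∑ i, c i := by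
  have hfib (a : α) (i : Fin s) :
      ∑ b with πβ b = i, ‖⟪h b, f a⟫_ℂ‖ * ‖⟪e a, g b⟫_ℂ‖ ≤ 1 := by
    have h1 := hh.sum_norm_inner_sq_le i (f a)
    have h2 := hg.sum_norm_inner_sq_le i (e a)
    rw [hf] at h1
    rw [he] at h2
    calc ∑ b with πβ b = i, ‖⟪h b, f a⟫_ℂ‖ * ‖⟪e a, g b⟫_ℂ‖
        ≤ ∑ b with πβ b = i, (‖⟪h b, f a⟫_ℂ‖ ^ 2 + ‖⟪g b, e a⟫_ℂ‖ ^ 2) / 2 := by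
          refine Finset.sum_le_sum fun b _ => ?_
          rw [norm_inner_symm (e a)]
          nlinarith [sq_nonneg (‖⟪h b, f a⟫_ℂ‖ - ‖⟪g b, e a⟫_ℂ‖)]
      _ ≤ 1 := by
          rw [← Finset.sum_div, Finset.sum_add_distrib]
          linarith
  calc ‖∑ b, ∑ a, singularMatrix A πα πβ e f g h b a * u a * w b‖
      ≤ ∑ b, ∑ a, M * ‖u a‖ * (c (πβ b) * (‖⟪h b, f a⟫_ℂ‖ * ‖⟪e a, g b⟫_ℂ‖)) := by
        refine (norm_sum_le _ _).trans (Finset.sum_le_sum fun b _ => (norm_sum_le _ _).trans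
          (Finset.sum_le_sum fun a _ => ?_))
        simp only [singularMatrix, norm_mul]
        have h1 := hM (πβ b) (πα a)
        have h2 := hw b
        have h3 : ‖A (πβ b) (πα a)‖ * ‖w b‖ ≤ M * c (πβ b) :=
          mul_le_mul h1 h2 (norm_nonneg _) ((norm_nonneg _).trans h1)
        calc _ = (‖A (πβ b) (πα a)‖ * ‖w b‖) * (‖u a‖ * (‖⟪h b, f a⟫_ℂ‖ * ‖⟪e a, g b⟫_ℂ‖)) := by
              ring
          _ ≤ (M * c (πβ b)) * (‖u a‖ * (‖⟪h b, f a⟫_ℂ‖ * ‖⟪e a, g b⟫_ℂ‖)) := by gcongr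
          _ = _ := by ring
    _ = ∑ a, M * ‖u a‖ * ∑ i, c i * ∑ b with πβ b = i, ‖⟪h b, f a⟫_ℂ‖ * ‖⟪e a, g b⟫_ℂ‖ := by
        rw [Finset.sum_comm]
        refine Finset.sum_congr rfl fun a _ => ?_
        rw [← Finset.mul_sum, ← Finset.sum_fiberwise Finset.univ πβ]
        congr 1
        refine Finset.sum_congr rfl fun i _ => ?_
        rw [Finset.mul_sum]
        refine Finset.sum_congr rfl fun b hb => ?_
        rw [(Finset.mem_filter.1 hb).2]
    _ ≤ ∑ a, M * ‖u a‖ * ∑ i, c i := by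
        refine Finset.sum_le_sum fun a _ => ?_
        rcases isEmpty_or_nonempty (Fin s) with hs | ⟨⟨i⟩⟩
        · simp
        have hM0 : 0 ≤ M := (norm_nonneg _).trans (hM i (πα a))
        gcongr with i
        exact mul_le_of_le_one_right (hc i) (hfib a i)
    _ = M * (∑ a, ‖u a‖) * ∑ i, c i := by
        simp only [← Finset.sum_mul, ← Finset.mul_sum]

/-- The form is ∑ aᵢⱼ tr(Zᵢ* Vⱼ) with Vⱼ = ∑ u_a ⟨e_a, ·⟩ f_a and Zᵢ = ∑ w̄_b ⟨g_b, ·⟩ h_b.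
Subunitarity and Cauchy–Schwarz bound it by Hilbert–Schmidt norms. -/
theorem norm_singularMatrix_le_l2 (hA : IsSubunitary A)
    (he : ∀ a, ‖e a‖ = 1) (hf : FiberOrthonormal πα f) (hg : ∀ b, ‖g b‖ = 1)
    (hh : FiberOrthonormal πβ h) (u : α → ℂ) (w : β → ℂ) :
    ‖∑ b, ∑ a, singularMatrix A πα πβ e f g h b a * u a * w b‖ ≤
      √(∑ a, ‖u a‖ ^ 2) * √(∑ b, ‖w b‖ ^ 2) := by
  -- The Vⱼ vanish on the orthogonal complement of this finite-dimensional span, so the traces can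
  -- be computed in its orthonormal basis `o`.
  let V := Submodule.span ℂ (Set.range e)
  have : FiniteDimensional ℂ V := FiniteDimensional.span_of_finite ℂ (Set.finite_range e)
  let o := stdOrthonormalBasis ℂ V
  have ho : Orthonormal ℂ fun m => (o m : H) := o.orthonormal.comp_linearIsometry V.subtypeₗᵢ
  have hexp (a : α) (b : β) : ⟪e a, g b⟫_ℂ = ∑ m, ⟪e a, o m⟫_ℂ * ⟪(o m : H), g b⟫_ℂ := by
    have h1 := congrArg Subtype.val (o.sum_repr' ⟨e a, Submodule.subset_span ⟨a, rfl⟩⟩)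
    have h2 : e a = ∑ m, ⟪(o m : H), e a⟫_ℂ • (o m : H) := by simpa using h1.symm
    conv_lhs => rw [h2, sum_inner]
    refine Finset.sum_congr rfl fun m _ => ?_
    rw [inner_smul_left, inner_conj_symm]
  have hbess {x : H} (hx : ‖x‖ = 1) : ∑ m, ‖⟪(o m : H), x⟫_ℂ‖ ^ 2 ≤ 1 := by
    have := ho.sum_inner_products_le (s := Finset.univ) x
    rwa [hx, one_pow] at this
  let v : Fin (Module.finrank ℂ V) → Fin t → H := fun m j =>
    ∑ a with πα a = j, (u a * ⟪e a, o m⟫_ℂ) • f a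
  let z : Fin (Module.finrank ℂ V) → Fin s → H := fun m i =>
    ∑ b with πβ b = i, (starRingEnd ℂ) (w b * ⟪(o m : H), g b⟫_ℂ) • h b
  have hsum : ∑ b, ∑ a, singularMatrix A πα πβ e f g h b a * u a * w b =
      ∑ m, ∑ i, ∑ j, A i j * ⟪z m i, v m j⟫_ℂ := by
    have h1 (m) : ∑ i, ∑ j, A i j * ⟪z m i, v m j⟫_ℂ = ∑ b, ∑ a, A (πβ b) (πα a) *
        ((w b * ⟪(o m : H), g b⟫_ℂ) * ((u a * ⟪e a, o m⟫_ℂ) * ⟪h b, f a⟫_ℂ)) := by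
      rw [← Finset.sum_fiberwise Finset.univ πβ]
      refine Finset.sum_congr rfl fun i _ => ?_
      simp only [← Finset.sum_fiberwise (Finset.univ : Finset α) πα]
      rw [Finset.sum_comm]
      refine Finset.sum_congr rfl fun j _ => ?_
      simp only [z, v]
      rw [sum_inner, Finset.mul_sum]
      refine Finset.sum_congr rfl fun b hb => ?_
      rw [inner_sum, Finset.mul_sum]
      refine Finset.sum_congr rfl fun a ha => ?_
      rw [(Finset.mem_filter.1 hb).2, (Finset.mem_filter.1 ha).2, inner_smul_left,
        inner_smul_right, Complex.conj_conj]
    simp only [h1]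
    symm
    rw [Finset.sum_comm]
    refine Finset.sum_congr rfl fun b _ => ?_
    rw [Finset.sum_comm]
    refine Finset.sum_congr rfl fun a _ => ?_
    rw [singularMatrix, hexp, Finset.mul_sum, Finset.sum_mul, Finset.sum_mul]
    refine Finset.sum_congr rfl fun m _ => ?_
    ring
  have hv : ∑ m, ∑ j, ‖v m j‖ ^ 2 ≤ ∑ a, ‖u a‖ ^ 2 := by
    have h1 (m) : ∑ j, ‖v m j‖ ^ 2 = ∑ a, ‖u a‖ ^ 2 * ‖⟪(o m : H), e a⟫_ℂ‖ ^ 2 := by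
      rw [← Finset.sum_fiberwise Finset.univ πα]
      refine Finset.sum_congr rfl fun j _ => ?_
      rw [hf.norm_sum_sq]
      refine Finset.sum_congr rfl fun a _ => ?_
      rw [norm_mul, mul_pow, norm_inner_symm]
    simp only [h1]
    rw [Finset.sum_comm]
    refine Finset.sum_le_sum fun a _ => ?_
    rw [← Finset.mul_sum]
    exact mul_le_of_le_one_right (sq_nonneg _) (hbess (he a))
  have hz : ∑ m, ∑ i, ‖z m i‖ ^ 2 ≤ ∑ b, ‖w b‖ ^ 2 := by
    have h1 (m) : ∑ i, ‖z m i‖ ^ 2 = ∑ b, ‖w b‖ ^ 2 * ‖⟪(o m : H), g b⟫_ℂ‖ ^ 2 := by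
      rw [← Finset.sum_fiberwise Finset.univ πβ]
      refine Finset.sum_congr rfl fun j _ => ?_
      rw [hh.norm_sum_sq]
      refine Finset.sum_congr rfl fun a _ => ?_
      rw [RCLike.norm_conj, norm_mul, mul_pow]
    simp only [h1]
    rw [Finset.sum_comm]
    refine Finset.sum_le_sum fun a _ => ?_
    rw [← Finset.mul_sum]
    exact mul_le_of_le_one_right (sq_nonneg _) (hbess (hg a))
  rw [hsum]
  calc ‖∑ m, ∑ i, ∑ j, A i j * ⟪z m i, v m j⟫_ℂ‖
      ≤ ∑ m, √(∑ j, ‖v m j‖ ^ 2) * √(∑ i, ‖z m i‖ ^ 2) :=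
        (norm_sum_le _ _).trans (Finset.sum_le_sum fun m _ => hA.norm_sum_inner_le _ _)
    _ ≤ √(∑ m, ∑ j, ‖v m j‖ ^ 2) * √(∑ m, ∑ i, ‖z m i‖ ^ 2) :=
        Real.sum_sqrt_mul_sqrt_le _ (fun m => Finset.sum_nonneg fun _ _ => sq_nonneg _)
          (fun m => Finset.sum_nonneg fun _ _ => sq_nonneg _)
    _ ≤ _ := by gcongr

end FiberOrthonormal

/-! ### The inequality (PQ) for subunitary matrices. -/

section ConjugateExponent

variable {H : Type*} [NormedAddCommGroup H] [InnerProductSpace ℂ H] {s t : ℕ}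
  {A : Matrix (Fin s) (Fin t) ℂ}

theorem norm_le_iSup_norm (A : Matrix (Fin s) (Fin t) ℂ) (i : Fin s) (j : Fin t) :
    ‖A i j‖ ≤ ⨆ ij : Fin s × Fin t, ‖A ij.1 ij.2‖ :=
  le_ciSup (f := fun ij : Fin s × Fin t => ‖A ij.1 ij.2‖) (Set.finite_range _).bddAbove (i, j)

theorem iSup_norm_nonneg (A : Matrix (Fin s) (Fin t) ℂ) :
    0 ≤ ⨆ ij : Fin s × Fin t, ‖A ij.1 ij.2‖ :=
  Real.iSup_nonneg fun _ => norm_nonneg _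

theorem IsSubunitary.iSup_norm_pos (hA : IsSubunitary A) (j : Fin t) :
    0 < ⨆ ij : Fin s × Fin t, ‖A ij.1 ij.2‖ := by
  refine lt_of_le_of_ne (iSup_norm_nonneg A) fun h => ?_
  have h0 (i : Fin s) : A i j = 0 := by
    have := norm_le_iSup_norm A i j
    rw [← h] at this
    exact norm_le_zero_iff.1 this
  have := hA.sum_conj_mul j j
  simp [h0] at this

theorem IsSubunitary.finiteSectionBound (hA : IsSubunitary A) {α β : Type*} {πα : α → Fin t}
    {πβ : β → Fin s} {e f : α → H} {g h : β → H} (he : FiberOrthonormal πα e)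
    (hf : FiberOrthonormal πα f) (hg : FiberOrthonormal πβ g) (hh : FiberOrthonormal πβ h)
    {p q : ℝ} (hp : p ≤ 2) (hpq : p.HolderConjugate q) :
    FiniteSectionBound πβ (singularMatrix A πα πβ e f g h)
      ((⨆ ij : Fin s × Fin t, ‖A ij.1 ij.2‖) ^ (2 / p - 1)) p q := by
  intro F G u w hu hw
  have hM0 := iSup_norm_nonneg A
  -- An element of F provides a column index, and thus max |aᵢⱼ| > 0, which the interpolation needs.
  rcases F.eq_empty_or_nonempty with rfl | ⟨a, -⟩
  · simp only [Finset.sum_empty, Finset.sum_const_zero, norm_zero]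
    have : 0 ≤ ∑ i, (∑ b ∈ G with πβ b = i, w b ^ q) ^ (p / q) :=
      Finset.sum_nonneg fun i _ => Real.rpow_nonneg (Finset.sum_nonneg fun b hb =>
        Real.rpow_nonneg (hw b (Finset.mem_filter.1 hb).1).le _) _
    positivity
  have hinjF : Function.Injective (Subtype.val : F → α) := Subtype.val_injective
  have hinjG : Function.Injective (Subtype.val : G → β) := Subtype.val_injective
  have key := norm_bilinear_le_interp (α := F) (β := G) (πβ ∘ Subtype.val)
    (singularMatrix A (πα ∘ Subtype.val) (πβ ∘ Subtype.val) (e ∘ Subtype.val) (f ∘ Subtype.val)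
      (g ∘ Subtype.val) (h ∘ Subtype.val)) (hA.iSup_norm_pos (πα a)) hp hpq
    (norm_singularMatrix_le_max (norm_le_iSup_norm A) (he.comp hinjF).1 (hf.comp hinjF).1
      (hg.comp hinjG) (hh.comp hinjG))
    (norm_singularMatrix_le_l2 hA (he.comp hinjF).1 (hf.comp hinjF)
      (hg.comp hinjG).1 (hh.comp hinjG))
    (s := fun a => u a) (σ := fun b => w b) (fun a => hu a a.2) (fun b => hw b b.2)
  have e1 : ∑ b : G, ∑ a : F, singularMatrix A (πα ∘ Subtype.val) (πβ ∘ Subtype.val)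
      (e ∘ Subtype.val) (f ∘ Subtype.val) (g ∘ Subtype.val) (h ∘ Subtype.val) b a * u a * w b =
      ∑ b ∈ G, ∑ a ∈ F, singularMatrix A πα πβ e f g h b a * u a * w b := by
    rw [← Finset.sum_coe_sort G]
    refine Finset.sum_congr rfl fun b _ => ?_
    rw [← Finset.sum_coe_sort F]
    rfl
  have e2 (i : Fin s) : ∑ b : G with (πβ ∘ Subtype.val) b = i, w b ^ q =
      ∑ b ∈ G with πβ b = i, w b ^ q := by
    rw [Finset.sum_filter, Finset.sum_filter, ← Finset.sum_coe_sort G]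
    rfl
  rw [e1, Finset.sum_coe_sort F fun a => u a ^ p] at key
  simpa only [e2] using key

theorem hasSum_sigma_of_fintype {ι M : Type*} [Fintype ι] {κ : ι → Type*} [AddCommMonoid M]
    [TopologicalSpace M] [ContinuousAdd M] {φ : (Σ i, κ i) → M} {c : ι → M}
    (h : ∀ i, HasSum (fun k => φ ⟨i, k⟩) (c i)) : HasSum φ (∑ i, c i) := by
  classical
  have h1 (i : ι) : HasSum (fun a : Σ i, κ i => if a.1 = i then φ a else 0) (c i) := by
    rw [← (sigma_mk_injective (i := i)).hasSum_iff]
    · simpa [Function.comp_def] using h i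
    · rintro ⟨j, k⟩ hjk
      refine if_neg fun hij => hjk ?_
      obtain rfl : j = i := hij
      exact ⟨k, rfl⟩
  have h2 := hasSum_sum (s := Finset.univ) fun i _ => h1 i
  simpa using h2

variable [CompleteSpace H]

theorem MemSchatten.exists_isSingularSystem {p : ℝ} (hp : 0 < p) {T : H →L[ℂ] H}
    (hT : MemSchatten p T) : ∃ (κ : Type) (e f : κ → H) (s : κ → ℝ), IsSingularSystem T e f s ∧
      HasSum (fun k => s k ^ p) (schattenNorm p T ^ p) := by
  obtain ⟨κ, e, f, s, h, hsum⟩ := exists_isSingularSystem_schattenSum hT.1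
  refine ⟨κ, e, f, s, h, ?_⟩
  have h1 := hT.2
  rw [schattenNorm_rpow hp, hsum]
  rw [hsum] at h1
  convert ENNReal.hasSum_toReal h1 using 1
  · funext k
    rw [← ENNReal.toReal_rpow, ENNReal.toReal_ofReal (h.pos k).le]
  · exact ENNReal.tsum_toReal_eq fun k => ENNReal.ne_top_of_tsum_ne_top h1 k

theorem schattenNorm_nonneg (p : ℝ) (T : H →L[ℂ] H) : 0 ≤ schattenNorm p T :=
  Real.rpow_nonneg ENNReal.toReal_nonneg _

theorem IsSingularSystem.inner_right_apply_left {κ : Type*} {T : H →L[ℂ] H} {e f : κ → H}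
    {s : κ → ℝ} (h : IsSingularSystem T e f s) (k : κ) : ⟪f k, T (e k)⟫_ℂ = s k := by
  rw [h.apply_left, inner_smul_right, inner_self_eq_norm_sq_to_K, h.orthonormal_right.1]
  simp

section

variable {κ : Fin t → Type*} {lam : Fin s → Type*} {e f : ∀ j, κ j → H} {g h : ∀ i, lam i → H}
  {σ : ∀ j, κ j → ℝ} {x : ∀ i, lam i → ℝ} {X : Fin s → H →L[ℂ] H} {Y : Fin t → H →L[ℂ] H}

theorem hasSum_singularMatrix_right (hX : ∀ i, IsSingularSystem (X i) (g i) (h i) (x i))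
    (hY : ∀ j, IsSingularSystem (Y j) (e j) (f j) (σ j)) (hXY : X = matrixAct A Y)
    (b : Σ i, lam i) :
    HasSum (fun a : Σ j, κ j => singularMatrix A Sigma.fst Sigma.fst (fun a => e a.1 a.2)
      (fun a => f a.1 a.2) (fun b => g b.1 b.2) (fun b => h b.1 b.2) b a * σ a.1 a.2)
      (x b.1 b.2 : ℂ) := by
  obtain ⟨i, l⟩ := b
  have h1 : (x i l : ℂ) = ∑ j, A i j * ⟪h i l, Y j (g i l)⟫_ℂ := by
    rw [← (hX i).inner_right_apply_left l, hXY]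
    simp only [matrixAct, sum_apply, smul_apply, inner_sum, inner_smul_right]
  rw [h1]
  refine hasSum_sigma_of_fintype fun j => ?_
  have h2 : HasSum (fun k => ⟪h i l, ((σ j k : ℂ) * ⟪e j k, g i l⟫_ℂ) • f j k⟫_ℂ)
      ⟪h i l, Y j (g i l)⟫_ℂ := ((hY j).hasSum_apply (g i l)).mapL (innerSL ℂ (h i l))
  refine (Filter.Tendsto.congr fun F => ?_) (h2.mul_left (A i j))
  refine Finset.sum_congr rfl fun k _ => ?_
  simp only [inner_smul_right, singularMatrix]
  ring

theorem hasSum_singularMatrix_left (hX : ∀ i, IsSingularSystem (X i) (g i) (h i) (x i))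
    (hY : ∀ j, IsSingularSystem (Y j) (e j) (f j) (σ j)) (hXY : Y = matrixAct Aᴴ X)
    (a : Σ j, κ j) :
    HasSum (fun b : Σ i, lam i => singularMatrix A Sigma.fst Sigma.fst (fun a => e a.1 a.2)
      (fun a => f a.1 a.2) (fun b => g b.1 b.2) (fun b => h b.1 b.2) b a * x b.1 b.2)
      (σ a.1 a.2 : ℂ) := by
  obtain ⟨j, k⟩ := a
  have h1 : (σ j k : ℂ) = ∑ i, A i j * (starRingEnd ℂ) ⟪f j k, X i (e j k)⟫_ℂ := by
    rw [← Complex.conj_ofReal, ← (hY j).inner_right_apply_left k, hXY]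
    simp only [matrixAct, sum_apply, smul_apply, inner_sum, inner_smul_right, map_sum, map_mul,
      Matrix.conjTranspose_apply, RCLike.star_def, Complex.conj_conj]
  rw [h1]
  refine hasSum_sigma_of_fintype fun i => ?_
  have h2 : HasSum (fun l => ⟪f j k, ((x i l : ℂ) * ⟪g i l, e j k⟫_ℂ) • h i l⟫_ℂ)
      ⟪f j k, X i (e j k)⟫_ℂ := ((hX i).hasSum_apply (e j k)).mapL (innerSL ℂ (f j k))
  refine (Filter.Tendsto.congr fun F => ?_) (h2.star.mul_left (A i j))
  refine Finset.sum_congr rfl fun l _ => ?_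
  simp only [inner_smul_right, singularMatrix, RCLike.star_def, map_mul, inner_conj_symm, Complex.conj_ofReal]
  ring

end

theorem IsSubunitary.clarksonMcCarthyPQ (hA : IsSubunitary A) {p : ℝ}
    {X : Fin s → H →L[ℂ] H} {Y : Fin t → H →L[ℂ] H} (hXY : SchattenRelated p A X Y) :
    ClarksonMcCarthyPQ p A X Y := by
  obtain ⟨hX, hY, hXA⟩ := hXY
  set M := ⨆ ij : Fin s × Fin t, ‖A ij.1 ij.2‖ with hM
  have hM0 : 0 ≤ M := iSup_norm_nonneg A
  have hYA : Y = matrixAct Aᴴ X := by rw [hXA, hA.matrixAct_conjTranspose]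
  rw [ClarksonMcCarthyPQ, ← hM]
  by_cases hp1 : 1 < p
  swap
  · exact ⟨fun h => absurd h hp1, fun h => absurd (by linarith) hp1⟩
  have hp0 : 0 < p := by linarith
  have hpq := Real.HolderConjugate.conjExponent hp1
  set q := p.conjExponent with hq
  have hq0 := hpq.symm.pos
  have hdiv : q / p = q - 1 := by
    have := hpq.mul_eq_add
    field_simp
    linarith
  choose lam g h x hx hxsum using fun i => (hX i).exists_isSingularSystem hp0
  choose κ e f σ hσ hσsum using fun j => (hY j).exists_isSingularSystem hp0
  have he := FiberOrthonormal.sigma fun j => (hσ j).orthonormal_left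
  have hf := FiberOrthonormal.sigma fun j => (hσ j).orthonormal_right
  have hg := FiberOrthonormal.sigma fun i => (hx i).orthonormal_left
  have hh := FiberOrthonormal.sigma fun i => (hx i).orthonormal_right
  have hB {p' q' : ℝ} (hp' : p' ≤ 2) (hpq' : p'.HolderConjugate q') :
      FiniteSectionBound (Sigma.fst : (Σ i, lam i) → Fin s)
        (singularMatrix A (Sigma.fst : (Σ j, κ j) → Fin t) Sigma.fst (fun a => e a.1 a.2)
          (fun a => f a.1 a.2) (fun b => g b.1 b.2) (fun b => h b.1 b.2))
        (M ^ (2 / p' - 1)) p' q' := hA.finiteSectionBound he hf hg hh hp' hpq'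
  have hσpos (a : Σ j, κ j) : 0 < σ a.1 a.2 := (hσ a.1).pos a.2
  have hxpos (b : Σ i, lam i) : 0 < x b.1 b.2 := (hx b.1).pos b.2
  have hS : HasSum (fun a : Σ j, κ j => σ a.1 a.2 ^ p) (∑ j, schattenNorm p (Y j) ^ p) :=
    hasSum_sigma_of_fintype hσsum
  have hn (i : Fin s) : HasSum (fun b : Σ i, lam i => if b.1 = i then x b.1 b.2 ^ p else 0)
      (schattenNorm p (X i) ^ p) := by
    have := hasSum_sigma_of_fintype (φ := fun b : Σ i, lam i =>
      if b.1 = i then x b.1 b.2 ^ p else 0) (c := fun i' => if i' = i then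
        schattenNorm p (X i') ^ p else 0) (fun i' => ?_)
    · simpa using this
    · by_cases hi : i' = i
      · simpa [hi] using hxsum i'
      · simp [hi]
  have hpow (r : ℝ) (i : Fin s) :
      (schattenNorm p (X i) ^ p) ^ (r / p) = schattenNorm p (X i) ^ r := by
    rw [← Real.rpow_mul (schattenNorm_nonneg _ _), mul_div_cancel₀ _ hp0.ne']
  refine ⟨fun _ h2 => ?_, fun h2 => ?_⟩
  · have key := (hB h2 hpq).sum_rpow_le (Real.rpow_nonneg hM0 _) hpq hσpos hxpos
      (hasSum_singularMatrix_right hx hσ hXA) hS hn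
    simp only [hpow] at key
    refine key.trans (le_of_eq ?_)
    rw [← Real.rpow_mul hM0]
    congr 2
    have : 2 / p * q = 2 * (q / p) := by ring
    rw [sub_mul, this, hdiv]
    ring
  · have hq2 : q ≤ 2 := by
      have : q * (p - 1) = p := by rw [mul_sub, mul_comm, hpq.mul_eq_add]; ring
      nlinarith
    -- Here q ≤ 2 plays the role of p. The result bounds the sum over Y from above; raising it to
    -- the power q/p and moving the constant across gives the reversed inequality.
    have key := (hB hq2 hpq.symm).le_rpow_sum (Real.rpow_nonneg hM0 _) hpq.symm hσpos hxpos
      (hasSum_singularMatrix_left hx hσ hYA) hS hn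
    simp only [hpow] at key
    set W := ∑ i, schattenNorm p (X i) ^ q with hW
    have hW0 : 0 ≤ W := Finset.sum_nonneg fun i _ => Real.rpow_nonneg (schattenNorm_nonneg _ _) _
    have hS0 : 0 ≤ ∑ j, schattenNorm p (Y j) ^ p :=
      Finset.sum_nonneg fun i _ => Real.rpow_nonneg (schattenNorm_nonneg _ _) _
    have hqp : 0 ≤ q / p := by positivity
    have h3 := Real.rpow_le_rpow hS0 key hqp
    rw [Real.mul_rpow (by positivity) (by positivity), ← Real.rpow_mul hW0,
      ← Real.rpow_mul (by positivity), ← Real.rpow_mul hM0, div_mul_div_cancel₀ hq0.ne',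
      div_self hp0.ne', Real.rpow_one] at h3
    have hexp : (2 / q - 1) * (p * (q / p)) = -(q / p - 1) := by
      rw [mul_div_cancel₀ _ hp0.ne', hdiv]; field_simp; ring
    rw [hexp] at h3
    calc M ^ (q / p - 1) * (∑ j, schattenNorm p (Y j) ^ p) ^ (q / p)
        ≤ M ^ (q / p - 1) * (M ^ (-(q / p - 1)) * W) := by gcongr
      _ = (M ^ (q / p - 1) * M ^ (-(q / p - 1))) * W := by ring
      _ ≤ 1 * W := by
          gcongr
          rw [Real.rpow_neg hM0]
          exact mul_inv_le_one
      _ = W := one_mul W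

end ConjugateExponent

/-! ### Finite rank operators lie in every Schatten class. -/

section FiniteRank

variable {H : Type*} [NormedAddCommGroup H] [InnerProductSpace ℂ H]

/-- Operators with finite-dimensional range. -/
def HasFiniteRank (T : H →L[ℂ] H) : Prop :=
  FiniteDimensional ℂ (LinearMap.range T.toLinearMap)

namespace HasFiniteRank

variable {T Z : H →L[ℂ] H}

theorem add (hT : HasFiniteRank T) (hZ : HasFiniteRank Z) : HasFiniteRank (T + Z) := by
  have h1 : FiniteDimensional ℂ (LinearMap.range T.toLinearMap) := hT
  have h2 : FiniteDimensional ℂ (LinearMap.range Z.toLinearMap) := hZ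
  exact Submodule.finiteDimensional_of_le
    (S₂ := LinearMap.range T.toLinearMap ⊔ LinearMap.range Z.toLinearMap)
    (LinearMap.range_add_le T.toLinearMap Z.toLinearMap)

theorem smul (c : ℂ) (hT : HasFiniteRank T) : HasFiniteRank (c • T) := by
  have h1 : FiniteDimensional ℂ (LinearMap.range T.toLinearMap) := hT
  refine Submodule.finiteDimensional_of_le (S₂ := LinearMap.range T.toLinearMap) ?_
  rintro _ ⟨x, rfl⟩
  exact Submodule.smul_mem _ c ⟨x, rfl⟩

theorem sum {ι : Type*} (s : Finset ι) {K : ι → H →L[ℂ] H} (h : ∀ i ∈ s, HasFiniteRank (K i)) :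
    HasFiniteRank (∑ i ∈ s, K i) := by
  refine Finset.sum_induction K HasFiniteRank (fun _ _ => add) ?_ h
  change FiniteDimensional ℂ (LinearMap.range (0 : H →ₗ[ℂ] H))
  rw [LinearMap.range_zero]
  infer_instance

theorem sub (hT : HasFiniteRank T) (hZ : HasFiniteRank Z) : HasFiniteRank (T - Z) := by
  have := hT.add (hZ.smul (-1))
  rwa [neg_smul, one_smul, ← sub_eq_add_neg] at this

theorem matrixAct {s t : ℕ} (A : Matrix (Fin s) (Fin t) ℂ) {Y : Fin t → H →L[ℂ] H}
    (hY : ∀ j, HasFiniteRank (Y j)) (i : Fin s) : HasFiniteRank (matrixAct A Y i) :=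
  sum _ fun j _ => (hY j).smul _

theorem isCompactOperator (hT : HasFiniteRank T) : IsCompactOperator T := by
  have h1 : FiniteDimensional ℂ (LinearMap.range T.toLinearMap) := hT
  have h2 : ProperSpace (LinearMap.range T.toLinearMap) := FiniteDimensional.proper ℂ _
  let S : H →L[ℂ] LinearMap.range T.toLinearMap := T.codRestrict _ fun x => ⟨x, rfl⟩
  have h3 : IsCompactOperator S := isCompactOperator_of_locallyCompactSpace_dom S
  exact h3.clm_comp (LinearMap.range T.toLinearMap).subtypeL

variable [CompleteSpace H]

theorem memSchatten (hT : HasFiniteRank T) (p : ℝ) (hp : 0 < p) : MemSchatten p T := by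
  refine ⟨hT.isCompactOperator, ?_⟩
  have h1 : FiniteDimensional ℂ (LinearMap.range T.toLinearMap) := hT
  obtain ⟨κ, e, f, s, h, hsum⟩ := exists_isSingularSystem_schattenSum hT.isCompactOperator
  have hmem (k : κ) : f k ∈ LinearMap.range T.toLinearMap := by
    refine ⟨((s k : ℂ)⁻¹) • e k, ?_⟩
    change T _ = _
    rw [map_smul, h.apply_left, smul_smul,
      inv_mul_cancel₀ (Complex.ofReal_ne_zero.2 (h.pos k).ne'), one_smul]
  -- The right singular vectors are independent in a finite-dimensional range, so there are finitely
  -- many singular values.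
  have hli : LinearIndependent ℂ fun k => (⟨f k, hmem k⟩ : LinearMap.range T.toLinearMap) :=
    LinearIndependent.of_comp (LinearMap.range T.toLinearMap).subtype
      h.orthonormal_right.linearIndependent
  have : Finite κ := hli.finite
  have := Fintype.ofFinite κ
  rw [hsum, tsum_fintype]
  exact ENNReal.sum_ne_top.2 fun k _ => ENNReal.rpow_ne_top_of_nonneg hp.le ENNReal.ofReal_ne_top

end HasFiniteRank

end FiniteRank

/-! ### The case p = 2: the Hilbert–Schmidt norm. -/

section HilbertSchmidt

variable {H : Type*} [NormedAddCommGroup H] [InnerProductSpace ℂ H] [CompleteSpace H]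

/-- Parseval for each e_k along b. The right-hand side is quadratic in T with b fixed, so the
parallelogram law passes from H to operators. -/
theorem schattenSum_two {T : H →L[ℂ] H} (hT : IsCompactOperator T) {ι : Type*}
    (b : HilbertBasis ι ℂ H) : schattenSum 2 T = ∑' m, ‖T (b m)‖ₑ ^ 2 := by
  obtain ⟨κ, e, f, s, h, hsum⟩ := exists_isSingularSystem_schattenSum hT
  have hb (k : κ) : ∑' m, ‖⟪b m, e k⟫_ℂ‖ₑ ^ 2 = 1 := by
    have h1 : HasSum (fun m => ⟪b m, e k⟫_ℂ • b m) (e k) := by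
      simpa only [b.repr_apply_apply] using b.hasSum_repr (e k)
    rw [b.orthonormal.tsum_enorm_sq h1, enorm_sq_eq_ofReal, h.orthonormal_left.1]
    simp
  rw [hsum]
  simp only [h.enorm_apply_sq]
  rw [ENNReal.tsum_comm]
  refine tsum_congr fun k => ?_
  rw [ENNReal.tsum_mul_left]
  simp only [enorm_inner_comm (e k), hb, mul_one]
  exact_mod_cast ENNReal.rpow_natCast _ 2

theorem schattenNorm_two_sq_parallelogram {T Z : H →L[ℂ] H} (hT : HasFiniteRank T)
    (hZ : HasFiniteRank Z) :
    schattenNorm 2 (T + Z) ^ (2 : ℝ) + schattenNorm 2 (T - Z) ^ (2 : ℝ) =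
      2 * (schattenNorm 2 T ^ (2 : ℝ) + schattenNorm 2 Z ^ (2 : ℝ)) := by
  obtain ⟨w, b, -⟩ := exists_hilbertBasis ℂ H
  have key : schattenSum 2 (T + Z) + schattenSum 2 (T - Z) =
      2 * (schattenSum 2 T + schattenSum 2 Z) := by
    rw [schattenSum_two (hT.add hZ).isCompactOperator b,
      schattenSum_two (hT.sub hZ).isCompactOperator b, schattenSum_two hT.isCompactOperator b,
      schattenSum_two hZ.isCompactOperator b, ← ENNReal.tsum_add, ← ENNReal.tsum_add,
      ← ENNReal.tsum_mul_left]
    refine tsum_congr fun m => ?_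
    simp only [enorm_sq_eq_ofReal, add_apply, sub_apply]
    rw [← ENNReal.ofReal_add (sq_nonneg _) (sq_nonneg _),
      ← ENNReal.ofReal_add (sq_nonneg _) (sq_nonneg _),
      show (2 : ℝ≥0∞) = ENNReal.ofReal 2 by simp, ← ENNReal.ofReal_mul zero_le_two]
    congr 1
    have := parallelogram_law_with_norm ℂ (T (b m)) (Z (b m))
    linarith
  have hfin {S : H →L[ℂ] H} (hS : HasFiniteRank S) : schattenSum 2 S ≠ ∞ :=
    (hS.memSchatten 2 two_pos).2
  simp only [schattenNorm_rpow two_pos]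
  rw [← ENNReal.toReal_add (hfin (hT.add hZ)) (hfin (hT.sub hZ)),
    ← ENNReal.toReal_add (hfin hT) (hfin hZ), key, ENNReal.toReal_mul]
  simp

theorem schattenNorm_two_sq_smul {T : H →L[ℂ] H} (hT : HasFiniteRank T) (c : ℂ) :
    schattenNorm 2 (c • T) ^ (2 : ℝ) = ‖c‖ ^ 2 * schattenNorm 2 T ^ (2 : ℝ) := by
  obtain ⟨w, b, -⟩ := exists_hilbertBasis ℂ H
  simp only [schattenNorm_rpow two_pos]
  rw [schattenSum_two (hT.smul c).isCompactOperator b, schattenSum_two hT.isCompactOperator b]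
  simp only [smul_apply, enorm_smul, mul_pow]
  rw [ENNReal.tsum_mul_left, ENNReal.toReal_mul, ENNReal.toReal_pow, toReal_enorm]

theorem schattenNorm_two_sq_ne_zero {T : H →L[ℂ] H} (hT : HasFiniteRank T) (h0 : T ≠ 0) :
    schattenNorm 2 T ^ (2 : ℝ) ≠ 0 := by
  obtain ⟨κ, e, f, s, h, hsum⟩ := exists_isSingularSystem_schattenSum hT.isCompactOperator
  rw [schattenNorm_rpow two_pos]
  intro h1
  rw [ENNReal.toReal_eq_zero_iff, or_iff_left (hT.memSchatten 2 two_pos).2, hsum,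
    ENNReal.tsum_eq_zero] at h1
  refine h0 (ContinuousLinearMap.ext fun x => h.apply_eq_zero x fun k => ?_)
  have h2 := h1 k
  rw [ENNReal.rpow_eq_zero_iff_of_pos two_pos, ENNReal.ofReal_eq_zero] at h2
  exact absurd (h.pos k) (not_lt.2 h2)

end HilbertSchmidt

/-! ### From the identity at p = 2 to subunitarity. -/

section Necessity

variable {H : Type*} [NormedAddCommGroup H] [InnerProductSpace ℂ H]

/-- In infinite dimension the rank one operators ⟨x, ·⟩ vⱼ with independent vⱼ serve; in finite
dimension any operators do. -/
theorem exists_linearIndependent_hasFiniteRank {t : ℕ}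
    (h : ∃ Y : Fin t → H →L[ℂ] H, LinearIndependent ℂ Y) :
    ∃ Y : Fin t → H →L[ℂ] H, LinearIndependent ℂ Y ∧ ∀ j, HasFiniteRank (Y j) := by
  by_cases hfin : FiniteDimensional ℂ H
  · obtain ⟨Y, hY⟩ := h
    exact ⟨Y, hY, fun j => FiniteDimensional.finiteDimensional_submodule _⟩
  · obtain ⟨v, hv⟩ : ∃ v : Fin t → H, LinearIndependent ℂ v :=
      exists_linearIndependent_of_le_rank (by
        rw [FiniteDimensional, ← Module.rank_lt_aleph0_iff, not_lt] at hfin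
        exact (Cardinal.natCast_lt_aleph0).le.trans hfin)
    have : Nontrivial H := by
      by_contra hn
      have := not_nontrivial_iff_subsingleton.1 hn
      exact hfin inferInstance
    obtain ⟨x, hx⟩ := exists_ne (0 : H)
    refine ⟨fun j => (innerSL ℂ x).smulRight (v j), ?_, fun j => ?_⟩
    · refine LinearIndependent.of_comp
        (ContinuousLinearMap.apply ℂ H ((⟪x, x⟫_ℂ)⁻¹ • x)).toLinearMap ?_
      convert hv using 1
      funext j
      have hxx : ⟪x, x⟫_ℂ ≠ 0 := inner_self_ne_zero.2 hx
      simp only [Function.comp_apply, ContinuousLinearMap.coe_coe, ContinuousLinearMap.apply_apply,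
        ContinuousLinearMap.smulRight_apply, innerSL_apply_apply, inner_smul_right,
        inv_mul_cancel₀ hxx, one_smul]
    · refine Submodule.finiteDimensional_of_le (S₂ := Submodule.span ℂ {v j}) ?_
      rintro _ ⟨y, rfl⟩
      exact Submodule.smul_mem _ _ (Submodule.mem_span_singleton_self _)

theorem isSubunitary_of_norm {s t : ℕ} {A : Matrix (Fin s) (Fin t) ℂ}
    (h : ∀ c : Fin t → ℂ, ∑ i, ‖∑ j, A i j * c j‖ ^ 2 = ∑ j, ‖c j‖ ^ 2) : IsSubunitary A := by
  let L : EuclideanSpace ℂ (Fin t) →ₗᵢ[ℂ] EuclideanSpace ℂ (Fin s) :=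
    { toLinearMap := Matrix.toEuclideanLin A
      norm_map' := fun x => by
        rw [← sq_eq_sq₀ (norm_nonneg _) (norm_nonneg _), EuclideanSpace.norm_sq_eq,
          EuclideanSpace.norm_sq_eq]
        exact h x }
  ext j k
  have h1 := L.inner_map_map (EuclideanSpace.single j 1) (EuclideanSpace.single k 1)
  have h2 (l : Fin t) (i : Fin s) : L (EuclideanSpace.single l 1) i = A i l := by
    change (Matrix.toEuclideanLin A (EuclideanSpace.single l 1)) i = A i l
    simp [Matrix.toLpLin_apply]
  rw [PiLp.inner_apply] at h1
  simp only [h2] at h1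
  rw [Matrix.mul_apply, Matrix.one_apply]
  simp only [Matrix.conjTranspose_apply]
  simpa [RCLike.inner_apply, EuclideanSpace.inner_single_left, mul_comm, eq_comm] using h1

variable [CompleteSpace H]

/-- The tuple (cⱼT) would give ‖Ac‖ = ‖c‖ at once but is not independent in general. It is therefore
added to and subtracted from an independent tuple, scaled by a small τ. -/
theorem isSubunitary_of_schattenNorm_two {s t : ℕ} {A : Matrix (Fin s) (Fin t) ℂ}
    (hH : ∃ Y : Fin t → H →L[ℂ] H, LinearIndependent ℂ Y)
    (h : ∀ Y : Fin t → H →L[ℂ] H, LinearIndependent ℂ Y → (∀ j, HasFiniteRank (Y j)) →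
      ∑ i, schattenNorm 2 (matrixAct A Y i) ^ (2 : ℝ) = ∑ j, schattenNorm 2 (Y j) ^ (2 : ℝ)) :
    IsSubunitary A := by
  obtain ⟨Y, hY, hYf⟩ := exists_linearIndependent_hasFiniteRank hH
  refine isSubunitary_of_norm fun c => ?_
  rcases Nat.eq_zero_or_pos t with rfl | ht
  · simp
  set T := Y ⟨0, ht⟩ with hT
  have hTf : HasFiniteRank T := hYf _
  have hT0 : schattenNorm 2 T ^ (2 : ℝ) ≠ 0 := schattenNorm_two_sq_ne_zero hTf (hY.ne_zero _)
  have hcont : Continuous fun τ : ℝ => fun j => Y j + ((τ : ℂ) * c j) • T := by fun_prop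
  have hopen : IsOpen {τ : ℝ | LinearIndependent ℂ fun j => Y j + ((τ : ℂ) * c j) • T} :=
    (isOpen_setOfPred_linearIndependent (𝕜 := ℂ)).preimage hcont
  have h0 : (0 : ℝ) ∈ {τ : ℝ | LinearIndependent ℂ fun j => Y j + ((τ : ℂ) * c j) • T} := by
    simpa using hY
  obtain ⟨ε, hε, hball⟩ := Metric.isOpen_iff.1 hopen 0 h0
  set τ := ε / 2 with hτ
  have hτ0 : 0 < τ := by positivity
  have hp : LinearIndependent ℂ fun j => Y j + ((τ : ℂ) * c j) • T :=
    hball (by simp [abs_of_pos hτ0]; linarith)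
  have hm : LinearIndependent ℂ fun j => Y j - ((τ : ℂ) * c j) • T := by
    have : LinearIndependent ℂ fun j => Y j + (((-τ : ℝ) : ℂ) * c j) • T :=
      hball (by simp [abs_of_pos hτ0]; linarith)
    simpa [sub_eq_add_neg] using this
  have hZf (j : Fin t) : HasFiniteRank (((τ : ℂ) * c j) • T) := hTf.smul _
  have hact (i : Fin s) : matrixAct A (fun j => ((τ : ℂ) * c j) • T) i =
      ((τ : ℂ) * ∑ j, A i j * c j) • T := by
    simp only [matrixAct, smul_smul, ← Finset.sum_smul, Finset.mul_sum]
    congr 1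
    refine Finset.sum_congr rfl fun j _ => ?_
    ring
  have hadd (i : Fin s) : matrixAct A (fun j => Y j + ((τ : ℂ) * c j) • T) i =
      matrixAct A Y i + ((τ : ℂ) * ∑ j, A i j * c j) • T := by
    rw [← hact]
    simp only [matrixAct, smul_add, Finset.sum_add_distrib]
  have hsub (i : Fin s) : matrixAct A (fun j => Y j - ((τ : ℂ) * c j) • T) i =
      matrixAct A Y i - ((τ : ℂ) * ∑ j, A i j * c j) • T := by
    rw [← hact]
    simp only [matrixAct, smul_sub, Finset.sum_sub_distrib]
  have e0 := h Y hY hYf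
  have e1 := h _ hp fun j => (hYf j).add (hZf j)
  have e2 := h _ hm fun j => (hYf j).sub (hZf j)
  simp only [hadd] at e1
  simp only [hsub] at e2
  -- The parallelogram law turns both sides into twice the part from Y, equal by `e0`, plus twice
  -- τ²‖T‖₂² times ‖Ac‖² and ‖c‖² respectively.
  have e3 : ∑ i, (schattenNorm 2 (matrixAct A Y i + ((τ : ℂ) * ∑ j, A i j * c j) • T) ^ (2 : ℝ) +
      schattenNorm 2 (matrixAct A Y i - ((τ : ℂ) * ∑ j, A i j * c j) • T) ^ (2 : ℝ)) =
      ∑ j, (schattenNorm 2 (Y j + ((τ : ℂ) * c j) • T) ^ (2 : ℝ) +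
        schattenNorm 2 (Y j - ((τ : ℂ) * c j) • T) ^ (2 : ℝ)) := by
    rw [Finset.sum_add_distrib, Finset.sum_add_distrib, e1, e2]
  rw [Finset.sum_congr rfl fun i _ => schattenNorm_two_sq_parallelogram
    (HasFiniteRank.matrixAct A hYf i) (hTf.smul _), Finset.sum_congr rfl fun j _ =>
    schattenNorm_two_sq_parallelogram (hYf j) (hZf j)] at e3
  simp only [schattenNorm_two_sq_smul hTf, ← Finset.mul_sum, Finset.sum_add_distrib, norm_mul,
    mul_pow, ← Finset.sum_mul] at e3
  rw [e0] at e3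
  have e4 : (‖(τ : ℂ)‖ ^ 2 * schattenNorm 2 T ^ (2 : ℝ)) * ∑ i, ‖∑ j, A i j * c j‖ ^ 2 =
      (‖(τ : ℂ)‖ ^ 2 * schattenNorm 2 T ^ (2 : ℝ)) * ∑ j, ‖c j‖ ^ 2 := by linarith
  refine mul_left_cancel₀ (mul_ne_zero ?_ hT0) e4
  simpa using hτ0.ne'

end Necessity

/-! ### Assembling the equivalences. -/

section Characterization

variable {H : Type*} [NormedAddCommGroup H] [InnerProductSpace ℂ H] [CompleteSpace H] {s t : ℕ}

theorem ClarksonMcCarthyPP.sum_schattenNorm_two_eq {X : Fin s → H →L[ℂ] H} {Y : Fin t → H →L[ℂ] H}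
    (h : ClarksonMcCarthyPP 2 X Y) :
    ∑ i, schattenNorm 2 (X i) ^ (2 : ℝ) = ∑ j, schattenNorm 2 (Y j) ^ (2 : ℝ) := by
  have h1 := h.1 le_rfl
  norm_num only [Real.rpow_zero, one_mul] at h1
  exact le_antisymm h1.2 h1.1

theorem ClarksonMcCarthyPQ.sum_schattenNorm_two_eq {A : Matrix (Fin s) (Fin t) ℂ}
    {X : Fin s → H →L[ℂ] H} {Y : Fin t → H →L[ℂ] H} (h : ClarksonMcCarthyPQ 2 A X Y) :
    ∑ i, schattenNorm 2 (X i) ^ (2 : ℝ) = ∑ j, schattenNorm 2 (Y j) ^ (2 : ℝ) := by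
  have hq : Real.conjExponent 2 = 2 := by norm_num [Real.conjExponent]
  have h1 := h.1 one_lt_two le_rfl
  have h2 := h.2 le_rfl
  rw [hq, div_self two_ne_zero, sub_self, Real.rpow_zero, one_mul, Real.rpow_one] at h1 h2
  exact le_antisymm h1 h2

theorem schattenRelated_matrixAct {p : ℝ} (hp : 0 < p) (A : Matrix (Fin s) (Fin t) ℂ)
    {Y : Fin t → H →L[ℂ] H} (hY : ∀ j, HasFiniteRank (Y j)) :
    SchattenRelated p A (matrixAct A Y) Y :=
  ⟨fun i => (HasFiniteRank.matrixAct A hY i).memSchatten p hp, fun j => (hY j).memSchatten p hp,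
    rfl⟩

theorem IsSubunitary.clarksonMcCarthy {A : Matrix (Fin s) (Fin t) ℂ} (hA : IsSubunitary A) {p : ℝ}
    (hp : 0 < p) {X : Fin s → H →L[ℂ] H} {Y : Fin t → H →L[ℂ] H} (h : SchattenRelated p A X Y) :
    SumSquaresEq X Y ∧ ClarksonMcCarthyPP p X Y ∧ ClarksonMcCarthyPQ p A X Y := by
  have h1 : SumSquaresEq X Y := by
    rw [h.2.2]
    exact hA.sumSquaresEq Y
  exact ⟨h1, clarksonMcCarthyPP_of_sumSquaresEq hp h.1 h.2.1 h1, hA.clarksonMcCarthyPQ h⟩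

end Characterization


theorem theorem1p10 {H : Type*} [NormedAddCommGroup H] [InnerProductSpace ℂ H] [CompleteSpace H]
    {s t : ℕ} (A : Matrix (Fin s) (Fin t) ℂ) :
    -- sufficiency, for arbitrary tuples related by a subunitary matrix
    (IsSubunitary A → ∀ p : ℝ, 0 < p → ∀ (X : Fin s → H →L[ℂ] H) (Y : Fin t → H →L[ℂ] H),
      SchattenRelated p A X Y →
        SumSquaresEq X Y ∧ ClarksonMcCarthyPP p X Y ∧ ClarksonMcCarthyPQ p A X Y) ∧
    -- sufficiency of the sum of squares identity for an arbitrary pair of tuples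
    (∀ p : ℝ, 0 < p → ∀ (X : Fin s → H →L[ℂ] H) (Y : Fin t → H →L[ℂ] H),
      (∀ i, MemSchatten p (X i)) → (∀ j, MemSchatten p (Y j)) → SumSquaresEq X Y →
        ClarksonMcCarthyPP p X Y) ∧
    -- the characterization, if `H` admits `t` linearly independent operators
    ((∃ Y : Fin t → H →L[ℂ] H, LinearIndependent ℂ Y) → ∀ p₀ : ℝ, 0 < p₀ →
      List.TFAE [
        IsSubunitary A,
        ∀ (X : Fin s → H →L[ℂ] H) (Y : Fin t → H →L[ℂ] H),
          SchattenRelated p₀ A X Y → LinearIndependent ℂ Y →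
            ∃ U : Matrix (Fin s) (Fin t) ℂ, IsSubunitary U ∧ X = matrixAct U Y,
        ∀ (X : Fin s → H →L[ℂ] H) (Y : Fin t → H →L[ℂ] H),
          SchattenRelated p₀ A X Y → LinearIndependent ℂ Y → SumSquaresEq X Y,
        ∀ p : ℝ, 0 < p → ∀ (X : Fin s → H →L[ℂ] H) (Y : Fin t → H →L[ℂ] H),
          SchattenRelated p A X Y → LinearIndependent ℂ Y →
            ClarksonMcCarthyPP p X Y ∧ ClarksonMcCarthyPQ p A X Y,
        ∀ p : ℝ, 0 < p → ∀ (X : Fin s → H →L[ℂ] H) (Y : Fin t → H →L[ℂ] H),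
          SchattenRelated p A X Y → LinearIndependent ℂ Y → ClarksonMcCarthyPP p X Y,
        ∀ p : ℝ, 1 < p → ∀ (X : Fin s → H →L[ℂ] H) (Y : Fin t → H →L[ℂ] H),
          SchattenRelated p A X Y → LinearIndependent ℂ Y → ClarksonMcCarthyPQ p A X Y]) := by
  refine ⟨fun hA p hp X Y h => hA.clarksonMcCarthy hp h,
    fun p hp X Y hX hY h => clarksonMcCarthyPP_of_sumSquaresEq hp hX hY h, fun hH p₀ hp₀ => ?_⟩
  tfae_have 1 → 2 := fun hA X Y h _ => ⟨A, hA, h.2.2⟩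
  tfae_have 2 → 3 := fun hb X Y h hY => by
    obtain ⟨U, hU, hXU⟩ := hb X Y h hY
    rw [hXU]
    exact hU.sumSquaresEq Y
  -- The sum of squares identity does not involve p, so from p₀ it carries over to p = 2 on finite
  -- rank tuples.
  tfae_have 3 → 1 := fun hc => isSubunitary_of_schattenNorm_two hH fun Y hY hYf => by
    have h2 := schattenRelated_matrixAct two_pos A hYf
    exact (clarksonMcCarthyPP_of_sumSquaresEq two_pos h2.1 h2.2.1
      (hc _ Y (schattenRelated_matrixAct hp₀ A hYf) hY)).sum_schattenNorm_two_eq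
  tfae_have 1 → 4 := fun hA p hp X Y h _ => (hA.clarksonMcCarthy hp h).2
  tfae_have 4 → 5 := fun hd p hp X Y h hY => (hd p hp X Y h hY).1
  tfae_have 4 → 6 := fun hd p hp X Y h hY => (hd p (zero_lt_one.trans hp) X Y h hY).2
  tfae_have 5 → 1 := fun he => isSubunitary_of_schattenNorm_two hH fun Y hY hYf =>
    (he 2 two_pos _ Y (schattenRelated_matrixAct two_pos A hYf) hY).sum_schattenNorm_two_eq
  tfae_have 6 → 1 := fun hf => isSubunitary_of_schattenNorm_two hH fun Y hY hYf =>
    (hf 2 one_lt_two _ Y (schattenRelated_matrixAct two_pos A hYf) hY).sum_schattenNorm_two_eq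
  tfae_finish
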